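/- Let $X$ be a non-empty metric space. For a real number $s>0$ and $x\in X$ let $C_s(x)$ be the $s$-connected component of $x$, i.e. the set of all $y\in X$ that can be joined to $x$ by a finite chain $y=z_0,z_1,\dots,z_n=x$ with $d(z_{i-1},z_i)\le s$ for all $i$. For $0<\delta\le\varepsilon$ let $$\theta^\varepsilon_\delta(X)=\min_{x\in X}\big|\{C_\delta(y):y\in C_\varepsilon(x)\}\big|,\qquad \Theta^\varepsilon_\delta(X)=\sup_{x\in X}\big|\{C_\delta(y):y\in C_\varepsilon(x)\}\big|.$$ $X$ has macro-uniform (asymptotic) dimension zero if for every $\delta<\infty$ there is $\varepsilon<\infty$ with $\operatorname{diam} C_\delta(x)\le\varepsilon$ for all $x\in X$. A multi-map $\Phi:X\Rightarrow Y$ between metric spaces is a subset $\Phi\subset X\times Y$, with $\Phi(A)=\{y:\exists a\in A,\ (a,y)\in\Phi\}$ and $\Phi^{-1}=\{(y,x):(x,y)\in\Phi\}$. It is macro-uniform if for every $\delta<\infty$ there is $\varepsilon<\infty$ such that $\operatorname{diam}\Phi(A)\le\varepsilon$ for every $A\subset X$ with $\operatorname{diam}A\le\delta$. The spaces $X,Y$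 are macro-uniformly equivalent if there is a multi-map $\Phi:X\Rightarrow Y$ with $\Phi(X)=Y$ and $\Phi^{-1}(Y)=X$ such that $\Phi$ and $\Phi^{-1}$ are macro-uniform. They are coarsely equivalent if there are (single-valued) maps $f:X\to Y$, $g:Y\to X$ such that for every $\delta<\infty$ there is $\varepsilon<\infty$ with $d(f(x),f(x'))\le\varepsilon$ whenever $d(x,x')\le\delta$, likewise for $g$, and $\sup_{x\in X} d(g(f(x)),x)<\infty$, $\sup_{y\in Y}d(f(g(y)),y)<\infty$. The Cantor bi-cube is $$2^{<\mathbb Z}=\{(x_i)_{i\in\mathbb Z}\in\{0,1\}^{\mathbb Z}:\exists n\in\mathbb N\ \forall i>n\ (x_i=0)\}$$ with the ultrametric $d((x_i),(y_i))=\max_{i\in\mathbb Z}2^i|x_i-y_i|$, and the extended Cantor set is $$\mathsf{EC}=\Big\{\sum_{i=-n}^\infty\frac{2x_i}{3^i}:n\in\mathbb N,\ (x_i)_{i\in\mathbb Z}\in\{0,1\}^{\mathbb Z}\Big\}\subset\mathbb R$$ with the metric of $\mathbb R$. **Theorem (Macro-Uniform Characterization of the Cantor bi-Cube).** A non-empty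 metric space $X$ is macro-uniformly equivalent to the Cantor bi-cube $2^{<\mathbb Z}$ if and only if 1. $X$ has macro-uniform dimension zero; and 2. there is $\delta>0$ such that $\Theta^\varepsilon_\delta(X)$ is finite for all real $\varepsilon\ge\delta$ and $\lim_{\varepsilon\to\infty}\theta^\varepsilon_\delta(X)=\infty$. Moreover, $X$ is coarsely equivalent to $2^{<\mathbb Z}$ if and only if it is macro-uniformly equivalent to $2^{<\mathbb Z}$, and $X$ is macro-uniformly equivalent to $\mathsf{EC}$ if and only if it is macro-uniformly equivalent to $2^{<\mathbb Z}$. -/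

import Mathlib

open scoped NNReal ENNReal Topology

section MultiMaps

variable {X : Type*} {Y : Type*} [MetricSpace X] [MetricSpace Y]

/-- The oscillation `ω_Φ(δ) = sup {diam Φ(A) : A ⊆ X, diam A ≤ δ}` of a multi-map
`Φ : X ⇒ Y`, that is, of an arbitrary subset `Φ ⊆ X × Y`. -/
noncomputable def multiOscillation (Φ : SetRel X Y) (δ : ℝ≥0) : ℝ≥0∞ :=
  ⨆ (A : Set X) (_ : Metric.ediam A ≤ (δ : ℝ≥0∞)), Metric.ediam (Φ.image A)

/-- A multi-map is macro-uniform if for every `δ < ∞` there is `ε < ∞` with `ω_Φ(δ) ≤ ε`. -/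
def IsMacroUniformMulti (Φ : SetRel X Y) : Prop :=
  ∀ δ : ℝ≥0, ∃ ε : ℝ≥0, multiOscillation Φ δ ≤ (ε : ℝ≥0∞)

/-- A macro-uniform equivalence: `Φ⁻¹(Y) = X`, `Φ(X) = Y`, and `Φ`, `Φ⁻¹` are macro-uniform. -/
structure IsMacroUniformEquivalence (Φ : SetRel X Y) : Prop where
  inv_image_univ : Φ.inv.image Set.univ = Set.univ
  image_univ : Φ.image Set.univ = Set.univ
  macroUniform : IsMacroUniformMulti Φ
  macroUniform_inv : IsMacroUniformMulti Φ.inv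

/-- The oscillation `ω_f(δ) = sup {dist (f x) (f x') : dist x x' ≤ δ}` of a map `f : X → Y`. -/
noncomputable def mapOscillation (f : X → Y) (δ : ℝ≥0) : ℝ≥0∞ :=
  ⨆ (x : X) (x' : X) (_ : dist x x' ≤ (δ : ℝ)), edist (f x) (f x')

/-- A map is macro-uniform if for every `δ < ∞` there is `ε < ∞` with `ω_f(δ) ≤ ε`. -/
def IsMacroUniformMap (f : X → Y) : Prop :=
  ∀ δ : ℝ≥0, ∃ ε : ℝ≥0, mapOscillation f δ ≤ (ε : ℝ≥0∞)

/-- A coarse equivalence: a macro-uniform map `f : X → Y` for which there is a macro-uniform map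
`g : Y → X` such that `f ∘ g` and `g ∘ f` are at finite distance from the identity maps. -/
def IsCoarseEquivalence (f : X → Y) : Prop :=
  IsMacroUniformMap f ∧ ∃ g : Y → X, IsMacroUniformMap g ∧
    (⨆ y : Y, edist (f (g y)) y) < ⊤ ∧ (⨆ x : X, edist (g (f x)) x) < ⊤

end MultiMaps

/-- Two metric spaces are macro-uniformly equivalent if there is a macro-uniform equivalence
`Φ : X ⇒ Y`. -/
def MacroUniformlyEquivalent (X : Type*) (Y : Type*) [MetricSpace X] [MetricSpace Y] : Prop :=
  ∃ Φ : SetRel X Y, IsMacroUniformEquivalence Φ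

/-- Two metric spaces are coarsely equivalent if there is a coarse equivalence `f : X → Y`. -/
def CoarselyEquivalent (X : Type*) (Y : Type*) [MetricSpace X] [MetricSpace Y] : Prop :=
  ∃ f : X → Y, IsCoarseEquivalence f

section Components

variable {X : Type*} [MetricSpace X]

/-- The `s`-connected component `C_s(x)`: all `y` that can be linked with `x` by a finite chain
of points whose consecutive distances are at most `s`. -/
def chainComponent (s : ℝ) (x : X) : Set X :=
  {y | Relation.ReflTransGen (fun a b : X => dist a b ≤ s) y x}

/-- The mesh `sup {diam C : C ∈ 𝒞}` of a family of subsets. -/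
noncomputable def mesh (𝒞 : Set (Set X)) : ℝ≥0∞ :=
  ⨆ C ∈ 𝒞, Metric.ediam C

/-- The number `|C_ε(x)/𝒞_δ(X)| = |{C_δ(y) : y ∈ C_ε(x)}|` of `δ`-connected components composing
`C_ε(x)`; it is `⊤` if there are infinitely many. -/
noncomputable def componentCount (δ ε : ℝ) (x : X) : ℕ∞ :=
  Set.encard (chainComponent δ '' chainComponent ε x)

end Components

/-- The family `𝒞_s(X) = {C_s(x) : x ∈ X}` of all `s`-connected components of `X`. -/
def chainComponents (X : Type*) [MetricSpace X] (s : ℝ) : Set (Set X) :=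
  Set.range (chainComponent (X := X) s)

/-- Macro-uniform (asymptotic) dimension zero: for every `δ < ∞` there is `ε < ∞` with
`mesh 𝒞_δ(X) ≤ ε`. -/
def MacroUniformDimensionZero (X : Type*) [MetricSpace X] : Prop :=
  ∀ δ : ℝ, 0 < δ → ∃ ε : ℝ≥0, mesh (chainComponents X δ) ≤ (ε : ℝ≥0∞)

/-- `θ_δ^ε(X)`, the minimum over `x ∈ X` of `|C_ε(x)/𝒞_δ(X)|`. -/
noncomputable def thetaMin (X : Type*) [MetricSpace X] (δ ε : ℝ) : ℕ∞ :=
  ⨅ x : X, componentCount δ ε x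

/-- `Θ_δ^ε(X)`, the supremum over `x ∈ X` of `|C_ε(x)/𝒞_δ(X)|`. -/
noncomputable def thetaSup (X : Type*) [MetricSpace X] (δ ε : ℝ) : ℕ∞ :=
  ⨆ x : X, componentCount δ ε x

/-- The Cantor bi-cube `2^{<ℤ}`: the two-sided `0`-`1` sequences `(x_i)` such that `x_i = 0` for
all `i > n`, for some natural number `n`. -/
def CantorBiCube : Type :=
  {x : ℤ → Fin 2 // ∃ n : ℕ, ∀ i : ℤ, (n : ℤ) < i → x i = 0}

namespace CantorBiCube

/-- The quantity `2^i |x_i - y_i|`. -/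
noncomputable def gap (x y : CantorBiCube) (i : ℤ) : ℝ :=
  (2 : ℝ) ^ i * |(((x.1 i : ℕ) : ℝ) - ((y.1 i : ℕ) : ℝ))|

theorem gap_nonneg (x y : CantorBiCube) (i : ℤ) : 0 ≤ gap x y i := by
  unfold gap; positivity

theorem gap_bddAbove (x y : CantorBiCube) : BddAbove (Set.range (gap x y)) := by
  obtain ⟨n, hn⟩ := x.2
  obtain ⟨m, hm⟩ := y.2
  refine ⟨(2 : ℝ) ^ ((max n m : ℕ) : ℤ), ?_⟩
  rintro _ ⟨i, rfl⟩
  unfold gap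
  by_cases hi : ((max n m : ℕ) : ℤ) < i
  · rw [hn i (by push_cast at hi; omega), hm i (by push_cast at hi; omega)]
    simp only [sub_self, abs_zero, mul_zero]
    positivity
  · have h1 : |(((x.1 i : ℕ) : ℝ) - ((y.1 i : ℕ) : ℝ))| ≤ 1 := by
      have hx : ((x.1 i : ℕ) : ℝ) ≤ 1 := by exact_mod_cast Nat.lt_succ_iff.mp (x.1 i).2
      have hy : ((y.1 i : ℕ) : ℝ) ≤ 1 := by exact_mod_cast Nat.lt_succ_iff.mp (y.1 i).2
      have hx0 : (0 : ℝ) ≤ ((x.1 i : ℕ) : ℝ) := Nat.cast_nonneg _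
      have hy0 : (0 : ℝ) ≤ ((y.1 i : ℕ) : ℝ) := Nat.cast_nonneg _
      rw [abs_le]; constructor <;> linarith
    calc (2 : ℝ) ^ i * |(((x.1 i : ℕ) : ℝ) - ((y.1 i : ℕ) : ℝ))|
        ≤ (2 : ℝ) ^ i * 1 := by gcongr
      _ = (2 : ℝ) ^ i := mul_one _
      _ ≤ (2 : ℝ) ^ ((max n m : ℕ) : ℤ) := zpow_le_zpow_right₀ (by norm_num) (not_lt.mp hi)

/-- The ultrametric `d(x, y) = max_{i ∈ ℤ} 2^i |x_i - y_i|` on the Cantor bi-cube. The supremum is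
over a set that is bounded above, and it is a maximum. -/
noncomputable instance : MetricSpace CantorBiCube where
  dist x y := ⨆ i : ℤ, gap x y i
  dist_self x := by simp [gap]
  dist_comm x y := by simp only [gap, abs_sub_comm]
  dist_triangle x y z := by
    refine ciSup_le fun i => ?_
    have h1 : gap x z i ≤ gap x y i + gap y z i := by
      unfold gap
      rw [← mul_add]
      exact mul_le_mul_of_nonneg_left (abs_sub_le _ _ _) (by positivity)
    exact h1.trans (add_le_add (le_ciSup (gap_bddAbove x y) i) (le_ciSup (gap_bddAbove y z) i))
  eq_of_dist_eq_zero := by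
    intro x y h
    apply Subtype.ext
    funext i
    have h0 : gap x y i = 0 :=
      le_antisymm ((le_ciSup (gap_bddAbove x y) i).trans h.le) (gap_nonneg x y i)
    unfold gap at h0
    have h2 : ((2 : ℝ) ^ i) ≠ 0 := by positivity
    have h3 := (mul_eq_zero.mp h0).resolve_left h2
    have h4 : ((x.1 i : ℕ) : ℝ) = ((y.1 i : ℕ) : ℝ) := sub_eq_zero.mp (abs_eq_zero.mp h3)
    exact Fin.ext (by exact_mod_cast h4)

end CantorBiCube

/-- The extended Cantor set: all real sums `∑_{i ≥ -n} 2 x_i / 3^i` with `n ∈ ℕ` and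
`x_i ∈ {0, 1}`, written with `i = k - n`, `k ∈ ℕ`. As a subtype of `ℝ` it carries the metric
of the real line. -/
def extendedCantorSet : Set ℝ :=
  {r | ∃ (n : ℕ) (x : ℤ → Fin 2),
    HasSum (fun k : ℕ => 2 * ((x ((k : ℤ) - n) : ℕ) : ℝ) / (3 : ℝ) ^ ((k : ℤ) - n)) r}

/-!
# Macro-uniform characterization of the Cantor bi-cube

All three equivalences between `X` and `Y` in question amount to the existence of a dense coarse
embedding `X → Y` (`macroUniformlyEquivalent_iff`, `coarselyEquivalent_iff`), a relation that is
symmetric and transitive. For the extended Cantor set such a map reads ternary digits as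
coordinates of the bi-cube.

If `f : X → 2^{<ℤ}` is a dense coarse embedding, chains in `X` are mapped to sets of controlled
diameter because the bi-cube is ultrametric. This gives dimension zero, and the numbers of
components are bounded above and below by counting coordinates.

Conversely, suppose `X` has dimension zero and satisfies the conditions on `θ` and `Θ`. For a
rapidly increasing sequence of scales, the components of `X` form a tower of sets
`T 0 → T 1 → T 2 → …`, where the weight of a component is the number of `δ`-components in it (times
a constant). The bi-cube corresponds to a regular tower `Y 0 → Y 1 → …`, in which all fibers at
level `n` have the same cardinality, a power of `2`. It suffices to interleave the two, that is, to
find maps `Y n → T n → Y (n + 1)` for some regular tower such that the composites of consecutive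
maps are the maps of the towers. Such an interleaving amounts to choosing the number `N n t` of
points of `Y n` over each `t : T n`, and to partitioning the fiber of `T n` over each
`x : T (n + 1)` into `N (n + 1) x` classes, so that the numbers `N n t` in each class have the same
prescribed sum. Given `N (n + 1)` nearly proportional to the weights, one finds `N n`, nearly
proportional again, by a greedy partition and rounding (`exists_partition_with_multiplicities`);
the errors are summable when the scales grow fast enough. This settles each finite part of the
tower, and a limit along an ultrafilter gives the whole of it (`WeightedTower.exists_coherent`).
Finally a regular tower is identified with the integer part of the bi-cube by choosing binary
digits on its fibers (`exists_biCube_coordinates`).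
-/

/-! ### Coarse equivalences as coarsely dense coarse embeddings -/

section CoarseEmbeddings

variable {X : Type*} {Y : Type*} {Z : Type*} [MetricSpace X] [MetricSpace Y] [MetricSpace Z]

/-- A coarsely dense coarse embedding: distances in `X` and distances between the images control
each other, and the image is a net in `Y`. Both notions of equivalence between metric spaces
reduce to the existence of such a map. -/
structure IsDenseCoarseEmbedding (f : X → Y) : Prop where
  /-- Distances between images are bounded in terms of distances between points. -/
  control : ∀ r : ℝ, ∃ s : ℝ, ∀ x x', dist x x' ≤ r → dist (f x) (f x') ≤ s
  /-- Distances between points are bounded in terms of distances between images. -/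
  control_inv : ∀ r : ℝ, ∃ s : ℝ, ∀ x x', dist (f x) (f x') ≤ r → dist x x' ≤ s
  /-- Every point of `Y` is at bounded distance from the image. -/
  dense : ∃ r : ℝ, ∀ y, ∃ x, dist (f x) y ≤ r

theorem IsDenseCoarseEmbedding.comp {g : Y → Z} {f : X → Y} (hg : IsDenseCoarseEmbedding g)
    (hf : IsDenseCoarseEmbedding f) : IsDenseCoarseEmbedding (g ∘ f) where
  control r := by
    obtain ⟨s, hs⟩ := hf.control r
    obtain ⟨t, ht⟩ := hg.control s
    exact ⟨t, fun x x' h => ht _ _ (hs _ _ h)⟩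
  control_inv r := by
    obtain ⟨s, hs⟩ := hg.control_inv r
    obtain ⟨t, ht⟩ := hf.control_inv s
    exact ⟨t, fun x x' h => ht _ _ (hs _ _ h)⟩
  dense := by
    obtain ⟨a, ha⟩ := hf.dense
    obtain ⟨b, hb⟩ := hg.dense
    obtain ⟨c, hc⟩ := hg.control a
    refine ⟨c + b, fun z => ?_⟩
    obtain ⟨y, hy⟩ := hb z
    obtain ⟨x, hx⟩ := ha y
    exact ⟨x, (dist_triangle _ (g y) _).trans (add_le_add (hc _ _ hx) hy)⟩

/-- Any choice of approximate preimages is a dense coarse embedding in the opposite direction. -/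
theorem IsDenseCoarseEmbedding.of_approx_inverse {f : X → Y} (hf : IsDenseCoarseEmbedding f)
    {g : Y → X} {r : ℝ} (hg : ∀ y, dist (f (g y)) y ≤ r) : IsDenseCoarseEmbedding g where
  control a := by
    obtain ⟨s, hs⟩ := hf.control_inv (r + a + r)
    refine ⟨s, fun y y' h => hs _ _ ?_⟩
    have h1 := dist_triangle4 (f (g y)) y y' (f (g y'))
    have h2 := hg y
    have h3 := hg y'
    rw [dist_comm] at h3
    linarith
  control_inv a := by
    obtain ⟨s, hs⟩ := hf.control a
    refine ⟨r + s + r, fun y y' h => ?_⟩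
    have h1 := dist_triangle4 y (f (g y)) (f (g y')) y'
    have h2 := hg y
    have h3 := hg y'
    have h4 := hs _ _ h
    rw [dist_comm] at h2
    linarith
  dense := by
    obtain ⟨s, hs⟩ := hf.control_inv r
    exact ⟨s, fun x => ⟨f x, hs _ _ (hg _)⟩⟩

theorem IsDenseCoarseEmbedding.exists_symm {f : X → Y} (hf : IsDenseCoarseEmbedding f) :
    ∃ g : Y → X, IsDenseCoarseEmbedding g := by
  obtain ⟨r, hr⟩ := hf.dense
  choose g hg using hr
  exact ⟨g, hf.of_approx_inverse hg⟩

theorem isMacroUniformMap_iff {f : X → Y} :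
    IsMacroUniformMap f ↔ ∀ r : ℝ, ∃ s : ℝ, ∀ x x', dist x x' ≤ r → dist (f x) (f x') ≤ s := by
  constructor
  · intro h r
    obtain ⟨ε, hε⟩ := h r.toNNReal
    refine ⟨ε, fun x x' hx => ?_⟩
    have : edist (f x) (f x') ≤ (ε : ℝ≥0∞) := by
      refine le_trans ?_ hε
      exact le_iSup₂_of_le x x' (le_iSup_of_le (hx.trans (Real.le_coe_toNNReal r)) le_rfl)
    rw [edist_nndist] at this
    rw [← coe_nndist]
    exact_mod_cast this
  · intro h δ
    obtain ⟨s, hs⟩ := h δ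
    refine ⟨s.toNNReal, iSup₂_le fun x x' => iSup_le fun hx => ?_⟩
    rw [edist_dist]
    exact ENNReal.ofReal_le_ofReal (hs _ _ hx)

theorem isMacroUniformMulti_iff {Φ : SetRel X Y} :
    IsMacroUniformMulti Φ ↔ ∀ r : ℝ, ∃ s : ℝ, ∀ x x' y y', (x, y) ∈ Φ → (x', y') ∈ Φ →
      dist x x' ≤ r → dist y y' ≤ s := by
  constructor
  · intro h r
    obtain ⟨ε, hε⟩ := h r.toNNReal
    refine ⟨ε, fun x x' y y' hy hy' hx => ?_⟩
    have : edist y y' ≤ (ε : ℝ≥0∞) := by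
      refine le_trans ?_ hε
      refine le_iSup₂_of_le ({x, x'} : Set X) ?_ ?_
      · rw [Metric.ediam_pair, edist_dist]
        exact ENNReal.ofReal_le_ofReal hx
      · exact Metric.edist_le_ediam_of_mem ⟨x, by simp, hy⟩ ⟨x', by simp, hy'⟩
    rw [edist_nndist] at this
    rw [← coe_nndist]
    exact_mod_cast this
  · intro h δ
    obtain ⟨s, hs⟩ := h δ
    refine ⟨s.toNNReal, iSup₂_le fun A hA => Metric.ediam_le ?_⟩
    rintro y ⟨x, hx, hxy⟩ y' ⟨x', hx', hxy'⟩
    rw [edist_dist]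
    refine ENNReal.ofReal_le_ofReal (hs _ _ _ _ hxy hxy' ?_)
    have := Metric.edist_le_of_ediam_le hx hx' hA
    rw [edist_nndist] at this
    rw [← coe_nndist]
    exact_mod_cast this

theorem macroUniformlyEquivalent_iff :
    MacroUniformlyEquivalent X Y ↔ ∃ f : X → Y, IsDenseCoarseEmbedding f := by
  constructor
  · rintro ⟨Φ, hΦ⟩
    have h1 : ∀ x, ∃ y, (x, y) ∈ Φ := fun x => by
      have : x ∈ Φ.inv.image Set.univ := by rw [hΦ.inv_image_univ]; trivial
      obtain ⟨y, -, hy⟩ := this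
      exact ⟨y, hy⟩
    choose f hf using h1
    refine ⟨f, ⟨fun r => ?_, fun r => ?_, ?_⟩⟩
    · obtain ⟨s, hs⟩ := isMacroUniformMulti_iff.1 hΦ.macroUniform r
      exact ⟨s, fun x x' h => hs x x' _ _ (hf x) (hf x') h⟩
    · obtain ⟨s, hs⟩ := isMacroUniformMulti_iff.1 hΦ.macroUniform_inv r
      exact ⟨s, fun x x' h => hs _ _ x x' (hf x) (hf x') h⟩
    · obtain ⟨s, hs⟩ := isMacroUniformMulti_iff.1 hΦ.macroUniform 0
      refine ⟨s, fun y => ?_⟩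
      have : y ∈ Φ.image Set.univ := by rw [hΦ.image_univ]; trivial
      obtain ⟨x, -, hx⟩ := this
      exact ⟨x, hs x x _ _ (hf x) hx (dist_self x).le⟩
  · rintro ⟨f, hf⟩
    obtain ⟨r, hr⟩ := hf.dense
    have hr' : ∀ x, dist (f x) (f x) ≤ max r 0 := fun x => by simp
    refine ⟨{p | dist (f p.1) p.2 ≤ max r 0}, ⟨?_, ?_, ?_, ?_⟩⟩
    · exact Set.eq_univ_of_forall fun x => ⟨f x, trivial, hr' x⟩
    · refine Set.eq_univ_of_forall fun y => ?_
      obtain ⟨x, hx⟩ := hr y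
      exact ⟨x, trivial, hx.trans (le_max_left _ _)⟩
    · refine isMacroUniformMulti_iff.2 fun a => ?_
      obtain ⟨s, hs⟩ := hf.control a
      refine ⟨max r 0 + s + max r 0, fun x x' y y' hy hy' hx => ?_⟩
      have h1 := dist_triangle4 y (f x) (f x') y'
      have h2 : dist (f x) y ≤ max r 0 := hy
      have h3 : dist (f x') y' ≤ max r 0 := hy'
      have h4 := hs _ _ hx
      rw [dist_comm] at h2
      linarith
    · refine isMacroUniformMulti_iff.2 fun a => ?_
      obtain ⟨s, hs⟩ := hf.control_inv (max r 0 + a + max r 0)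
      refine ⟨s, fun y y' x x' hy hy' hx => hs _ _ ?_⟩
      have h1 := dist_triangle4 (f x) y y' (f x')
      have h2 : dist (f x) y ≤ max r 0 := hy
      have h3 : dist (f x') y' ≤ max r 0 := hy'
      rw [dist_comm] at h3
      linarith

theorem iSup_edist_lt_top_iff {ι : Type*} {u v : ι → X} :
    (⨆ i, edist (u i) (v i)) < ⊤ ↔ ∃ r : ℝ, ∀ i, dist (u i) (v i) ≤ r := by
  constructor
  · intro h
    refine ⟨(⨆ i, edist (u i) (v i)).toReal, fun i => ?_⟩
    rw [dist_edist]
    exact ENNReal.toReal_mono h.ne (le_iSup (fun i => edist (u i) (v i)) i)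
  · rintro ⟨r, hr⟩
    refine lt_of_le_of_lt (iSup_le fun i => ?_) (ENNReal.ofReal_lt_top (r := r))
    rw [edist_dist]
    exact ENNReal.ofReal_le_ofReal (hr i)

theorem coarselyEquivalent_iff :
    CoarselyEquivalent X Y ↔ ∃ f : X → Y, IsDenseCoarseEmbedding f := by
  constructor
  · rintro ⟨f, hf, g, hg, hfg, hgf⟩
    rw [isMacroUniformMap_iff] at hf hg
    obtain ⟨a, ha⟩ := iSup_edist_lt_top_iff.1 hfg
    obtain ⟨b, hb⟩ := iSup_edist_lt_top_iff.1 hgf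
    refine ⟨f, ⟨hf, fun r => ?_, a, fun y => ⟨g y, ha y⟩⟩⟩
    obtain ⟨s, hs⟩ := hg r
    refine ⟨b + s + b, fun x x' h => ?_⟩
    have h1 := dist_triangle4 x (g (f x)) (g (f x')) x'
    have h2 := hb x
    have h3 := hb x'
    have h4 := hs _ _ h
    rw [dist_comm] at h2
    linarith
  · rintro ⟨f, hf⟩
    obtain ⟨r, hr⟩ := hf.dense
    choose g hg using hr
    obtain ⟨s, hs⟩ := hf.control_inv r
    exact ⟨f, isMacroUniformMap_iff.2 hf.control, g,
      isMacroUniformMap_iff.2 (hf.of_approx_inverse hg).control,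
      iSup_edist_lt_top_iff.2 ⟨r, hg⟩, iSup_edist_lt_top_iff.2 ⟨s, fun x => hs _ _ (hg _)⟩⟩

end CoarseEmbeddings

/-! ### Chain components -/

section ChainComponents

variable {X : Type*} [MetricSpace X] {s t : ℝ} {x y z : X}

theorem mem_chainComponent_self : x ∈ chainComponent s x := Relation.ReflTransGen.refl

theorem mem_chainComponent_of_dist_le (h : dist y x ≤ s) : y ∈ chainComponent s x :=
  Relation.ReflTransGen.single h

theorem mem_chainComponent_symm (h : y ∈ chainComponent s x) : x ∈ chainComponent s y := by
  induction h with
  | refl => exact Relation.ReflTransGen.refl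
  | tail _ hbc ih =>
    rw [dist_comm] at hbc
    exact Relation.ReflTransGen.head hbc ih

theorem mem_chainComponent_trans (h : z ∈ chainComponent s y) (h' : y ∈ chainComponent s x) :
    z ∈ chainComponent s x :=
  Relation.ReflTransGen.trans h h'

theorem mem_chainComponent_mono (hst : s ≤ t) (h : y ∈ chainComponent s x) :
    y ∈ chainComponent t x :=
  Relation.ReflTransGen.mono (fun _ _ hab => hab.trans hst) _ _ h

theorem chainComponent_eq_iff :
    chainComponent s y = chainComponent s x ↔ y ∈ chainComponent s x := by
  constructor
  · intro h
    rw [← h]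
    exact mem_chainComponent_self
  · intro h
    ext z
    exact ⟨fun hz => mem_chainComponent_trans hz h,
      fun hz => mem_chainComponent_trans hz (mem_chainComponent_symm h)⟩

theorem macroUniformDimensionZero_iff :
    MacroUniformDimensionZero X ↔
      ∀ r : ℝ, ∃ s : ℝ, ∀ x y : X, y ∈ chainComponent r x → dist y x ≤ s := by
  constructor
  · intro h r
    obtain ⟨ε, hε⟩ := h (max r 1) (by positivity)
    refine ⟨ε, fun x y hy => ?_⟩
    have h1 : Metric.ediam (chainComponent (max r 1) x) ≤ ε :=
      le_trans (le_iSup₂_of_le (chainComponent (max r 1) x) ⟨x, rfl⟩ le_rfl) hε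
    have := Metric.edist_le_of_ediam_le (mem_chainComponent_mono (le_max_left r 1) hy)
      mem_chainComponent_self h1
    rw [edist_nndist] at this
    rw [← coe_nndist]
    exact_mod_cast this
  · intro h δ _
    obtain ⟨s, hs⟩ := h δ
    refine ⟨s.toNNReal, iSup₂_le ?_⟩
    rintro _ ⟨x, rfl⟩
    refine Metric.ediam_le fun y hy z hz => ?_
    rw [edist_dist]
    exact ENNReal.ofReal_le_ofReal
      (hs _ _ (mem_chainComponent_trans hy (mem_chainComponent_symm hz)))

end ChainComponents

/-! ### The Cantor bi-cube -/

namespace CantorBiCube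

theorem gap_of_ne {x y : CantorBiCube} {i : ℤ} (h : x.1 i ≠ y.1 i) : gap x y i = 2 ^ i := by
  have : ∀ a b : Fin 2, a ≠ b → |((a : ℕ) : ℝ) - ((b : ℕ) : ℝ)| = 1 := by
    intro a b
    fin_cases a <;> fin_cases b <;> simp
  rw [gap, this _ _ h, mul_one]

theorem gap_of_eq {x y : CantorBiCube} {i : ℤ} (h : x.1 i = y.1 i) : gap x y i = 0 := by
  simp [gap, h]

theorem dist_le_two_zpow_iff {x y : CantorBiCube} {k : ℤ} :
    dist x y ≤ (2 : ℝ) ^ k ↔ ∀ i, k < i → x.1 i = y.1 i := by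
  constructor
  · intro h i hi
    by_contra hne
    have h1 : gap x y i ≤ dist x y := le_ciSup (gap_bddAbove x y) i
    rw [gap_of_ne hne] at h1
    exact absurd (h1.trans h) (not_le.2 (zpow_lt_zpow_right₀ (by norm_num) hi))
  · intro h
    refine ciSup_le fun i => ?_
    by_cases hi : x.1 i = y.1 i
    · rw [gap_of_eq hi]
      positivity
    · rw [gap_of_ne hi]
      exact zpow_le_zpow_right₀ (by norm_num) (not_lt.1 fun hk => hi (h i hk))

theorem exists_le_two_zpow (r : ℝ) : ∃ k : ℕ, r ≤ (2 : ℝ) ^ (k : ℤ) := by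
  obtain ⟨n, hn⟩ := pow_unbounded_of_one_lt r (one_lt_two (α := ℝ))
  exact ⟨n, by rw [zpow_natCast]; exact hn.le⟩

/-- The bi-cube is ultrametric: points joined by a chain of steps of size at most `2 ^ k` after
applying `f` are at distance at most `2 ^ k`. -/
theorem dist_le_of_mem_chainComponent {X : Type*} [MetricSpace X] {f : X → CantorBiCube} {r : ℝ}
    {k : ℤ} (hf : ∀ x x', dist x x' ≤ r → dist (f x) (f x') ≤ (2 : ℝ) ^ k) {x y : X}
    (h : y ∈ chainComponent r x) : dist (f y) (f x) ≤ (2 : ℝ) ^ k := by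
  induction h with
  | refl =>
    rw [dist_self]
    positivity
  | tail _ hbc ih =>
    rw [dist_le_two_zpow_iff] at ih ⊢
    have h2 := dist_le_two_zpow_iff.1 (hf _ _ hbc)
    exact fun i hi => (ih i hi).trans (h2 i hi)

/-- The point obtained from `x` by flipping the coordinate `j`. -/
def flip (x : CantorBiCube) (j : ℤ) : CantorBiCube :=
  ⟨Function.update x.1 j (x.1 j + 1), by
    obtain ⟨n, hn⟩ := x.2
    refine ⟨max n j.toNat, fun i hi => ?_⟩
    have h1 : i ≠ j := by omega
    rw [Function.update_of_ne h1]
    exact hn i (by omega)⟩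

theorem flip_apply_of_ne (x : CantorBiCube) {i j : ℤ} (h : i ≠ j) : (flip x j).1 i = x.1 i :=
  Function.update_of_ne h _ _

theorem flip_apply_ne (x : CantorBiCube) (j : ℤ) : (flip x j).1 j ≠ x.1 j := by
  have : ∀ a : Fin 2, a + 1 ≠ a := by decide
  simp [flip, this]

end CantorBiCube

section Necessity

variable {X : Type*} [MetricSpace X] {f : X → CantorBiCube}

theorem IsDenseCoarseEmbedding.macroUniformDimensionZero (hf : IsDenseCoarseEmbedding f) :
    MacroUniformDimensionZero X := by
  refine macroUniformDimensionZero_iff.2 fun r => ?_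
  obtain ⟨s, hs⟩ := hf.control r
  obtain ⟨k, hk⟩ := CantorBiCube.exists_le_two_zpow s
  obtain ⟨t, ht⟩ := hf.control_inv ((2 : ℝ) ^ (k : ℤ))
  exact ⟨t, fun x y hy => ht _ _
    (CantorBiCube.dist_le_of_mem_chainComponent (fun a b hab => (hs a b hab).trans hk) hy)⟩

/-- If images at distance at most `1` come from points at distance at most `δ`, then a
`δ`-component inside an `ε`-component is determined by boundedly many coordinates. -/
theorem IsDenseCoarseEmbedding.thetaSup_lt_top (hf : IsDenseCoarseEmbedding f) {δ : ℝ}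
    (hδ : ∀ x x', dist (f x) (f x') ≤ 1 → dist x x' ≤ δ) (ε : ℝ) : thetaSup X δ ε < ⊤ := by
  obtain ⟨s, hs⟩ := hf.control ε
  obtain ⟨k, hk⟩ := CantorBiCube.exists_le_two_zpow s
  have key : ∀ x : X, componentCount δ ε x ≤ ((Fintype.card (Fin k → Fin 2) : ℕ) : ℕ∞) := by
    intro x
    let code : X → (Fin k → Fin 2) := fun y i => (f y).1 (i + 1)
    have hinj : ∀ y ∈ chainComponent ε x, ∀ z ∈ chainComponent ε x, code y = code z →
        chainComponent δ y = chainComponent δ z := by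
      intro y hy z hz hyz
      refine chainComponent_eq_iff.2 (mem_chainComponent_of_dist_le (hδ y z ?_))
      rw [← zpow_zero (2 : ℝ), CantorBiCube.dist_le_two_zpow_iff]
      intro i hi
      by_cases hik : i ≤ k
      · have h1 := congrFun hyz ⟨(i - 1).toNat, by omega⟩
        have h2 : (((i - 1).toNat : ℕ) : ℤ) + 1 = i := by omega
        simpa only [code, h2] using h1
      · have h1 : ∀ w ∈ chainComponent ε x, (f w).1 i = (f x).1 i := fun w hw =>
          CantorBiCube.dist_le_two_zpow_iff.1 (CantorBiCube.dist_le_of_mem_chainComponent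
            (fun a b hab => (hs a b hab).trans hk) hw) i (by omega)
        rw [h1 y hy, h1 z hz]
    classical
    -- the component of a point is a function of its code
    let g : (Fin k → Fin 2) → Set X := fun c =>
      if h : ∃ y ∈ chainComponent ε x, code y = c then chainComponent δ h.choose else ∅
    have hsub : chainComponent δ '' chainComponent ε x ⊆ g '' Set.univ := by
      rintro _ ⟨y, hy, rfl⟩
      refine ⟨code y, trivial, ?_⟩
      have h : ∃ y' ∈ chainComponent ε x, code y' = code y := ⟨y, hy, rfl⟩
      simp only [g, dif_pos h]
      exact hinj _ h.choose_spec.1 _ hy h.choose_spec.2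
    calc componentCount δ ε x ≤ (g '' Set.univ).encard := Set.encard_le_encard hsub
      _ ≤ (Set.univ : Set (Fin k → Fin 2)).encard := Set.encard_image_le _ _
      _ = _ := by rw [Set.encard_univ, ENat.card_eq_coe_fintype_card]
  exact lt_of_le_of_lt (iSup_le key) (ENat.natCast_lt_top _)

/-- Points whose images approximate the points obtained from `f x` by flipping distinct high
coordinates lie in distinct `δ`-components. -/
theorem IsDenseCoarseEmbedding.tendsto_thetaMin (hf : IsDenseCoarseEmbedding f) (δ : ℝ) :
    Filter.Tendsto (fun ε : ℝ => thetaMin X δ ε) Filter.atTop (𝓝 ⊤) := by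
  obtain ⟨R, hR⟩ := hf.dense
  obtain ⟨s, hs⟩ := hf.control δ
  obtain ⟨J, hJ⟩ := CantorBiCube.exists_le_two_zpow (max R s)
  choose g hg using hR
  refine ENat.tendsto_nhds_top_iff_natCast_lt.2 fun M => ?_
  obtain ⟨ε₀, hε₀⟩ := hf.control_inv ((2 : ℝ) ^ ((J + M + 1 : ℕ) : ℤ))
  filter_upwards [Filter.eventually_ge_atTop ε₀] with ε hε
  have key : ∀ x : X, ((M + 1 : ℕ) : ℕ∞) ≤ componentCount δ ε x := by
    intro x
    -- exponents above `J` survive the approximation error `R` and separate `δ`-components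
    let p : Fin (M + 1) → X := fun t => g (CantorBiCube.flip (f x) (J + 1 + (t : ℕ)))
    have hp : ∀ t i, (J : ℤ) < i →
        (f (p t)).1 i = (CantorBiCube.flip (f x) (J + 1 + (t : ℕ))).1 i := fun t i hi =>
      CantorBiCube.dist_le_two_zpow_iff.1 ((hg _).trans ((le_max_left _ _).trans hJ)) i hi
    have hmem : ∀ t, p t ∈ chainComponent ε x := fun t => by
      refine mem_chainComponent_of_dist_le ((hε₀ _ _ ?_).trans hε)
      rw [CantorBiCube.dist_le_two_zpow_iff]
      intro i hi
      have := t.2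
      push_cast at hi
      rw [hp t i (by omega), CantorBiCube.flip_apply_of_ne _ (by omega)]
    have hinj : Function.Injective fun t => chainComponent δ (p t) := by
      intro t u htu
      by_contra hne
      have h1 := CantorBiCube.dist_le_two_zpow_iff.1 (CantorBiCube.dist_le_of_mem_chainComponent
        (fun a b hab => (hs a b hab).trans ((le_max_right _ _).trans hJ))
        (chainComponent_eq_iff.1 htu)) (J + 1 + (t : ℕ)) (by omega)
      have h2 : (J : ℤ) + 1 + (t : ℕ) ≠ J + 1 + (u : ℕ) := fun h => hne (Fin.ext (by omega))
      rw [hp t _ (by omega), hp u _ (by omega), CantorBiCube.flip_apply_of_ne _ h2] at h1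
      exact CantorBiCube.flip_apply_ne _ _ h1
    calc ((M + 1 : ℕ) : ℕ∞) = (Set.univ : Set (Fin (M + 1))).encard := by
          rw [Set.encard_univ, ENat.card_eq_coe_fintype_card, Fintype.card_fin]
      _ = ((fun t => chainComponent δ (p t)) '' Set.univ).encard :=
          (hinj.encard_image _).symm
      _ ≤ componentCount δ ε x := by
          refine Set.encard_le_encard ?_
          rintro _ ⟨t, -, rfl⟩
          exact ⟨p t, hmem t, rfl⟩
  refine lt_of_lt_of_le ?_ (le_iInf key)
  exact_mod_cast Nat.lt_succ_self M

end Necessity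

/-! ### The extended Cantor set -/

namespace CantorBiCube

/-- The `i`-th term of the ternary expansion attached to a point of the bi-cube; the `i`-th digit
of the bi-cube has weight `3 ^ i`. -/
noncomputable def ternaryTerm (v : CantorBiCube) (i : ℤ) : ℝ := 2 * ((v.1 i : ℕ) : ℝ) * 3 ^ i

theorem injective_sub_natCast (m : ℤ) : Function.Injective fun k : ℕ => m - (k : ℤ) :=
  fun a b h => by
    have : m - (a : ℤ) = m - b := h
    omega

theorem notMem_range_sub_natCast {m i : ℤ} (h : i ∉ Set.range fun k : ℕ => m - (k : ℤ)) :
    m < i := by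
  by_contra hi
  exact h ⟨(m - i).toNat, by simp only; omega⟩

theorem mem_extendedCantorSet_iff {r : ℝ} :
    r ∈ extendedCantorSet ↔ ∃ v : CantorBiCube, HasSum v.ternaryTerm r := by
  constructor
  · rintro ⟨n, x, hx⟩
    refine ⟨⟨fun i => if i ≤ n then x (-i) else 0, n, fun i hi => if_neg (by omega)⟩, ?_⟩
    rw [← (injective_sub_natCast n).hasSum_iff]
    · convert hx using 2 with k
      have h1 : (n : ℤ) - k ≤ n := by omega
      have h2 : (n : ℤ) - k = -(k - n) := by ring
      simp only [Function.comp, ternaryTerm, h1, if_true]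
      rw [h2, zpow_neg, neg_neg, div_eq_mul_inv]
    · intro i hi
      have := notMem_range_sub_natCast hi
      simp [ternaryTerm, not_le.2 this]
  · rintro ⟨v, hv⟩
    obtain ⟨n, hn⟩ := v.2
    refine ⟨n, fun i => v.1 (-i), ?_⟩
    rw [← (injective_sub_natCast n).hasSum_iff] at hv
    · convert hv using 2 with k
      have h2 : (n : ℤ) - k = -(k - n) := by ring
      simp only [Function.comp, ternaryTerm]
      rw [h2, zpow_neg, div_eq_mul_inv]
    · intro i hi
      simp [ternaryTerm, hn i (notMem_range_sub_natCast hi)]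

theorem hasSum_two_mul_three_zpow (m : ℤ) :
    HasSum (fun i : ℤ => if i ≤ m then 2 * (3 : ℝ) ^ i else 0) (3 ^ (m + 1)) := by
  rw [← (injective_sub_natCast m).hasSum_iff]
  · have h := (hasSum_geometric_of_lt_one (r := (3 : ℝ)⁻¹) (by norm_num) (by norm_num)).mul_left
      (2 * (3 : ℝ) ^ m)
    have h1 : 2 * (3 : ℝ) ^ m * (1 - 3⁻¹)⁻¹ = 3 ^ (m + 1) := by
      rw [zpow_add₀ (by norm_num)]
      norm_num
      ring
    have h2 : (fun k : ℕ => 2 * (3 : ℝ) ^ m * 3⁻¹ ^ k)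
        = (fun i : ℤ => if i ≤ m then 2 * (3 : ℝ) ^ i else 0) ∘ fun k : ℕ => m - (k : ℤ) := by
      funext k
      have h3 : m - (k : ℤ) ≤ m := by omega
      simp only [Function.comp, h3, if_true]
      rw [zpow_sub₀ (by norm_num), zpow_natCast, inv_pow]
      ring
    rwa [h1, h2] at h
  · intro i hi
    simp [not_le.2 (notMem_range_sub_natCast hi)]

theorem abs_ternaryTerm_sub_of_ne {v w : CantorBiCube} {i : ℤ} (h : v.1 i ≠ w.1 i) :
    |v.ternaryTerm i - w.ternaryTerm i| = 2 * 3 ^ i := by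
  have h1 : ∀ a b : Fin 2, a ≠ b → |((a : ℕ) : ℝ) - ((b : ℕ) : ℝ)| = 1 := by
    intro a b
    fin_cases a <;> fin_cases b <;> simp
  have h2 : v.ternaryTerm i - w.ternaryTerm i
      = 2 * 3 ^ i * (((v.1 i : ℕ) : ℝ) - ((w.1 i : ℕ) : ℝ)) := by
    simp only [ternaryTerm]
    ring
  rw [h2, abs_mul, h1 _ _ h, mul_one, abs_of_pos (by positivity)]

theorem abs_ternaryTerm_sub_le (v w : CantorBiCube) (i : ℤ) :
    |v.ternaryTerm i - w.ternaryTerm i| ≤ 2 * 3 ^ i := by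
  by_cases h : v.1 i = w.1 i
  · simp only [ternaryTerm, h, sub_self, abs_zero]
    positivity
  · exact (abs_ternaryTerm_sub_of_ne h).le

theorem summable_ternaryTerm (v : CantorBiCube) : Summable v.ternaryTerm := by
  obtain ⟨n, hn⟩ := v.2
  refine Summable.of_norm_bounded (hasSum_two_mul_three_zpow n).summable fun i => ?_
  have h := abs_ternaryTerm_sub_le v ⟨fun _ => 0, 0, fun _ _ => rfl⟩ i
  have h0 : ternaryTerm ⟨fun _ => 0, 0, fun _ _ => rfl⟩ i = 0 := by simp [ternaryTerm]
  rw [h0, sub_zero] at h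
  split_ifs with hi
  · exact h
  · simp [ternaryTerm, hn i (not_le.1 hi)]

variable {v w : CantorBiCube} {r r' : ℝ}

theorem abs_sub_le_of_agree (hv : HasSum v.ternaryTerm r) (hw : HasSum w.ternaryTerm r') {m : ℤ}
    (h : ∀ i, m < i → v.1 i = w.1 i) : |r - r'| ≤ 3 ^ (m + 1) := by
  refine (hv.sub hw).norm_le_of_bounded (hasSum_two_mul_three_zpow m) fun i => ?_
  split_ifs with hi
  · exact abs_ternaryTerm_sub_le v w i
  · simp [ternaryTerm, h i (not_le.1 hi)]

/-- The top differing digit outweighs all lower ones: it contributes `2 * 3 ^ m`, the lower ones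
at most `3 ^ m` in total. -/
theorem three_zpow_le_abs_sub (hv : HasSum v.ternaryTerm r) (hw : HasSum w.ternaryTerm r') {m : ℤ}
    (h : ∀ i, m < i → v.1 i = w.1 i) (hm : v.1 m ≠ w.1 m) : 3 ^ m ≤ |r - r'| := by
  have h1 := (hv.sub hw).update m 0
  have h2 := h1.norm_le_of_bounded (hasSum_two_mul_three_zpow (m - 1)) fun i => by
    by_cases him : i = m
    · subst him
      simp
    · rw [Function.update_of_ne him]
      split_ifs with hi
      · exact abs_ternaryTerm_sub_le v w i
      · simp [ternaryTerm, h i (by omega)]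
  rw [Real.norm_eq_abs, sub_add_cancel] at h2
  have h3 := abs_ternaryTerm_sub_of_ne hm
  have h6 : |0 - (v.ternaryTerm m - w.ternaryTerm m) + (r - r')| ≤ 3 ^ m := h2
  have h7 := abs_sub_abs_le_abs_sub (v.ternaryTerm m - w.ternaryTerm m) (r - r')
  have h8 : |v.ternaryTerm m - w.ternaryTerm m - (r - r')|
      = |0 - (v.ternaryTerm m - w.ternaryTerm m) + (r - r')| := by
    rw [← abs_neg]
    ring_nf
  rw [h8, h3] at h7
  linarith

theorem agree_of_abs_sub_lt (hv : HasSum v.ternaryTerm r) (hw : HasSum w.ternaryTerm r') {k : ℤ}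
    (h : |r - r'| < 3 ^ (k + 1)) : ∀ i, k < i → v.1 i = w.1 i := by
  by_contra! hne
  obtain ⟨i, hi, hvw⟩ := hne
  obtain ⟨n, hn⟩ := v.2
  obtain ⟨n', hn'⟩ := w.2
  obtain ⟨m, ⟨hm, hkm⟩, hmax⟩ := Int.exists_greatest_of_bdd
    (P := fun j => v.1 j ≠ w.1 j ∧ k < j) ⟨max n n', fun j hj => by
      by_contra hlt
      exact hj.1 ((hn j (by omega)).trans (hn' j (by omega)).symm)⟩ ⟨i, hvw, hi⟩
  have h1 := three_zpow_le_abs_sub hv hw (m := m) (fun j hj => by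
    by_contra hne
    have := hmax j ⟨hne, by omega⟩
    omega) hm
  have h2 : (3 : ℝ) ^ (k + 1) ≤ 3 ^ m := zpow_le_zpow_right₀ (by norm_num) (by omega)
  linarith

end CantorBiCube

/-- Reading ternary digits as coordinates of the bi-cube is a coarse equivalence. -/
theorem exists_isDenseCoarseEmbedding_extendedCantorSet :
    ∃ f : extendedCantorSet → CantorBiCube, IsDenseCoarseEmbedding f := by
  have h : ∀ r : extendedCantorSet, ∃ v : CantorBiCube, HasSum v.ternaryTerm r :=
    fun r => CantorBiCube.mem_extendedCantorSet_iff.1 r.2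
  choose f hf using h
  refine ⟨f, ⟨fun a => ?_, fun a => ?_, 0, fun v => ?_⟩⟩
  · obtain ⟨k, hk⟩ := pow_unbounded_of_one_lt a (by norm_num : (1 : ℝ) < 3)
    refine ⟨2 ^ (k : ℤ), fun x x' hx => CantorBiCube.dist_le_two_zpow_iff.2 ?_⟩
    refine CantorBiCube.agree_of_abs_sub_lt (hf x) (hf x') ?_
    rw [Subtype.dist_eq, Real.dist_eq] at hx
    refine hx.trans_lt (hk.trans ?_)
    rw [← zpow_natCast]
    exact zpow_lt_zpow_right₀ (by norm_num) (by omega)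
  · obtain ⟨k, hk⟩ := CantorBiCube.exists_le_two_zpow a
    refine ⟨3 ^ ((k : ℤ) + 1), fun x x' hx => ?_⟩
    rw [Subtype.dist_eq, Real.dist_eq]
    exact CantorBiCube.abs_sub_le_of_agree (hf x) (hf x')
      (CantorBiCube.dist_le_two_zpow_iff.1 (hx.trans hk))
  · have hv := v.summable_ternaryTerm.hasSum
    let r : extendedCantorSet := ⟨_, CantorBiCube.mem_extendedCantorSet_iff.2 ⟨v, hv⟩⟩
    refine ⟨r, le_of_eq (dist_eq_zero.2 (Subtype.ext (funext fun i => ?_)))⟩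
    refine CantorBiCube.agree_of_abs_sub_lt (hf r) hv (k := i - 1) ?_ i (by omega)
    rw [sub_self, abs_zero]
    positivity

/-! ### Balanced partitions of finite weighted sets -/

section FiniteCombinatorics

variable {ι : Type*}

/-- Putting each element in turn into a lightest class keeps the loads of any two classes within
the largest weight of each other. -/
theorem exists_balanced_partition (I : Finset ι) (s : ι → ℝ) {B : ℝ} (hB : 0 ≤ B)
    (hs : ∀ i ∈ I, 0 ≤ s i ∧ s i ≤ B) {g : ℕ} (hg : 0 < g) :
    ∃ γ : ι → Fin g, ∀ j k,
      (∑ i ∈ I with γ i = j, s i) ≤ (∑ i ∈ I with γ i = k, s i) + B := by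
  classical
  have : Nonempty (Fin g) := ⟨⟨0, hg⟩⟩
  simp only [Finset.sum_filter]
  induction I using Finset.induction_on with
  | empty => exact ⟨fun _ => ⟨0, hg⟩, by simpa using hB⟩
  | insert a I ha ih =>
    obtain ⟨γ, hγ⟩ := ih fun i hi => hs i (Finset.mem_insert_of_mem hi)
    obtain ⟨j₀, hj₀⟩ := Finite.exists_min fun j => ∑ i ∈ I, if γ i = j then s i else 0
    have ha' := hs a (Finset.mem_insert_self a I)
    have key : ∀ j, (∑ i ∈ insert a I, if Function.update γ a j₀ i = j then s i else 0)
        = (if j₀ = j then s a else 0) + ∑ i ∈ I, if γ i = j then s i else 0 := by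
      intro j
      rw [Finset.sum_insert ha, Function.update_self]
      congr 1
      refine Finset.sum_congr rfl fun i hi => ?_
      rw [Function.update_of_ne (ne_of_mem_of_not_mem hi ha)]
    refine ⟨Function.update γ a j₀, fun j k => ?_⟩
    rw [key, key]
    have h1 := hγ j k
    have h2 := hj₀ k
    split_ifs with hj hk hk
    · subst hj
      linarith
    · subst hj
      linarith
    · linarith
    · linarith

theorem exists_sum_eq_of_sum_le (I : Finset ι) (L U : ι → ℕ) (h : ∀ i ∈ I, L i ≤ U i) {M : ℕ}
    (hL : ∑ i ∈ I, L i ≤ M) (hU : M ≤ ∑ i ∈ I, U i) :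
    ∃ N : ι → ℕ, (∀ i ∈ I, L i ≤ N i ∧ N i ≤ U i) ∧ ∑ i ∈ I, N i = M := by
  classical
  induction I using Finset.induction_on generalizing M with
  | empty =>
    simp only [Finset.sum_empty] at hU
    exact ⟨0, by simp, by simp; omega⟩
  | insert a I ha ih =>
    rw [Finset.sum_insert ha] at hL hU
    have haLU := h a (Finset.mem_insert_self a I)
    have hI : ∑ i ∈ I, L i ≤ ∑ i ∈ I, U i :=
      Finset.sum_le_sum fun i hi => h i (Finset.mem_insert_of_mem hi)
    obtain ⟨b, hb1, hb2, hb3, hb4, hb5⟩ : ∃ b, L a ≤ b ∧ b ≤ U a ∧ b ≤ M ∧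
        ∑ i ∈ I, L i ≤ M - b ∧ M - b ≤ ∑ i ∈ I, U i :=
      ⟨min (U a) (M - ∑ i ∈ I, L i), by omega, by omega, by omega, by omega, by omega⟩
    obtain ⟨N, hN, hsum⟩ := ih (fun i hi => h i (Finset.mem_insert_of_mem hi)) hb4 hb5
    refine ⟨Function.update N a b, fun i hi => ?_, ?_⟩
    · by_cases hia : i = a
      · subst hia
        simpa using ⟨hb1, hb2⟩
      · rw [Function.update_of_ne hia]
        exact hN i ((Finset.mem_insert.1 hi).resolve_left hia)
    · rw [Finset.sum_insert ha, Function.update_self,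
        Finset.sum_congr rfl fun i hi => Function.update_of_ne (ne_of_mem_of_not_mem hi ha) _ _,
        hsum]
      omega

/-- A weighted finite set whose total weight is proportional to `g * P`, up to a factor in
`[α', β']`, can be split into `g` classes and each element can be given a multiplicity
proportional to its weight, up to a factor in the wider interval `[α, β]`, such that the
multiplicities in each class add up to exactly `P`. The widening absorbs two roundings: weights
are at most `κ` times the ideal class load, and the unit `D` is at most `η` times each weight. -/
theorem exists_partition_with_multiplicities (I : Finset ι) (s : ι → ℝ)
    {D B α α' β β' η κ : ℝ} {P g : ℕ} (hD : 0 < D) (hB : 0 ≤ B)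
    (hs : ∀ i ∈ I, 0 ≤ s i ∧ s i ≤ B) (hDs : ∀ i ∈ I, D ≤ η * s i) (hBP : B ≤ κ * (P * D))
    (hα0 : 0 ≤ α) (hη0 : 0 ≤ η) (hα'0 : 0 < α') (hβ'0 : 0 < β') (hαβ : α + η ≤ β - η)
    (hα : (α + η) * (1 + κ * α') ≤ α') (hβ : β' ≤ (β - η) * (1 - κ * β')) (hg : 0 < g)
    (hgα : α' * ∑ i ∈ I, s i ≤ g * (P * D)) (hgβ : g * (P * D) ≤ β' * ∑ i ∈ I, s i) :
    ∃ (N : ι → ℕ) (γ : ι → Fin g), (∀ i ∈ I, α * s i ≤ N i * D ∧ N i * D ≤ β * s i) ∧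
      ∀ j, ∑ i ∈ I with γ i = j, N i = P := by
  classical
  obtain ⟨γ, hγ⟩ := exists_balanced_partition I s hB hs hg
  have hg' : (0 : ℝ) < g := by exact_mod_cast hg
  have hPD : (0 : ℝ) ≤ P * D := by positivity
  set S := ∑ i ∈ I, s i with hS
  set ℓ : Fin g → ℝ := fun j => ∑ i ∈ I with γ i = j, s i with hℓ
  have hℓS : ∑ j, ℓ j = S := Finset.sum_fiberwise I γ s
  -- each load is within `B` of the average load `S / g`
  have hup : ∀ j, g * ℓ j ≤ S + g * B := fun j => by
    have := Finset.sum_le_sum (s := Finset.univ) fun k (_ : k ∈ Finset.univ) => hγ j k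
    rw [Finset.sum_add_distrib] at this
    simp only [Finset.sum_const, Finset.card_univ, Fintype.card_fin, nsmul_eq_mul] at this
    rwa [← hℓS]
  have hlo : ∀ j, S ≤ g * ℓ j + g * B := fun j => by
    have := Finset.sum_le_sum (s := Finset.univ) fun k (_ : k ∈ Finset.univ) => hγ k j
    simp only [Finset.sum_const, Finset.card_univ, Fintype.card_fin, nsmul_eq_mul] at this
    rw [← hℓS]
    linarith
  have hℓup : ∀ j, (α + η) * ℓ j ≤ P * D := fun j => by
    have h1 : g * (α' * ℓ j) ≤ g * (P * D * (1 + κ * α')) := by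
      have h2 := mul_le_mul_of_nonneg_left (hup j) hα'0.le
      have h3 := mul_le_mul_of_nonneg_left hBP (mul_nonneg hα'0.le hg'.le)
      linarith
    have h4 := le_of_mul_le_mul_left h1 hg'
    have h5 : α' * ((α + η) * ℓ j) ≤ α' * (P * D) := by
      have h6 := mul_le_mul_of_nonneg_left h4 (add_nonneg hα0 hη0)
      have h7 := mul_le_mul_of_nonneg_right hα hPD
      linarith
    exact le_of_mul_le_mul_left h5 hα'0
  have hℓlo : ∀ j, P * D ≤ (β - η) * ℓ j := fun j => by
    have h1 : g * (P * D * (1 - κ * β')) ≤ g * (β' * ℓ j) := by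
      have h2 := mul_le_mul_of_nonneg_left (hlo j) hβ'0.le
      have h3 := mul_le_mul_of_nonneg_left hBP (mul_nonneg hβ'0.le hg'.le)
      linarith
    have h4 := le_of_mul_le_mul_left h1 hg'
    have h5 : β' * (P * D) ≤ β' * ((β - η) * ℓ j) := by
      have h6 := mul_le_mul_of_nonneg_left h4 (le_trans (add_nonneg hα0 hη0) hαβ)
      have h7 := mul_le_mul_of_nonneg_right hβ hPD
      linarith
    exact le_of_mul_le_mul_left h5 hβ'0
  -- the least and the greatest admissible multiplicity of each element; summed over a class, they
  -- enclose `P`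
  let L : ι → ℕ := fun i => ⌈α * s i / D⌉₊
  let U : ι → ℕ := fun i => ⌊β * s i / D⌋₊
  have hβ0 : 0 ≤ β := by linarith
  have hL1 : ∀ i, α * s i ≤ L i * D := fun i => (div_le_iff₀ hD).1 (Nat.le_ceil _)
  have hL2 : ∀ i ∈ I, L i * D ≤ (α + η) * s i := fun i hi => by
    have h1 : (L i : ℝ) < α * s i / D + 1 :=
      Nat.ceil_lt_add_one (div_nonneg (mul_nonneg hα0 (hs i hi).1) hD.le)
    have h2 := mul_le_mul_of_nonneg_right h1.le hD.le
    rw [add_mul, div_mul_cancel₀ _ hD.ne'] at h2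
    linarith [hDs i hi]
  have hU1 : ∀ i ∈ I, U i * D ≤ β * s i := fun i hi =>
    (le_div_iff₀ hD).1 (Nat.floor_le (div_nonneg (mul_nonneg hβ0 (hs i hi).1) hD.le))
  have hU2 : ∀ i ∈ I, (β - η) * s i ≤ U i * D := fun i hi => by
    have h1 : β * s i / D < (U i : ℝ) + 1 := Nat.lt_floor_add_one _
    have h2 := mul_le_mul_of_nonneg_right h1.le hD.le
    rw [add_mul, div_mul_cancel₀ _ hD.ne'] at h2
    linarith [hDs i hi]
  have hLU : ∀ i ∈ I, L i ≤ U i := fun i hi => by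
    have h1 := mul_le_mul_of_nonneg_right hαβ (hs i hi).1
    have h2 : (L i : ℝ) * D ≤ U i * D := ((hL2 i hi).trans h1).trans (hU2 i hi)
    exact_mod_cast le_of_mul_le_mul_right h2 hD
  have hN : ∀ j : Fin g, ∃ N : ι → ℕ,
      (∀ i ∈ I.filter (fun i => γ i = j), L i ≤ N i ∧ N i ≤ U i) ∧
        ∑ i ∈ I with γ i = j, N i = P := fun j => by
    refine exists_sum_eq_of_sum_le _ L U (fun i hi => hLU i (Finset.mem_filter.1 hi).1) ?_ ?_
    · have h1 : ((∑ i ∈ I with γ i = j, L i : ℕ) : ℝ) * D ≤ P * D := by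
        refine le_trans ?_ (hℓup j)
        push_cast
        rw [Finset.sum_mul, Finset.mul_sum]
        exact Finset.sum_le_sum fun i hi => hL2 i (Finset.mem_filter.1 hi).1
      exact_mod_cast le_of_mul_le_mul_right h1 hD
    · have h1 : (P : ℝ) * D ≤ ((∑ i ∈ I with γ i = j, U i : ℕ) : ℝ) * D := by
        refine le_trans (hℓlo j) ?_
        push_cast
        rw [Finset.sum_mul, Finset.mul_sum]
        exact Finset.sum_le_sum fun i hi => hU2 i (Finset.mem_filter.1 hi).1
      exact_mod_cast le_of_mul_le_mul_right h1 hD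
  choose N hN1 hN2 using hN
  refine ⟨fun i => N (γ i) i, γ, fun i hi => ?_, fun j => ?_⟩
  · obtain ⟨h1, h2⟩ := hN1 (γ i) i (Finset.mem_filter.2 ⟨hi, rfl⟩)
    refine ⟨(hL1 i).trans (mul_le_mul_of_nonneg_right (by exact_mod_cast h1) hD.le),
      le_trans (mul_le_mul_of_nonneg_right (by exact_mod_cast h2) hD.le) (hU1 i hi)⟩
  · rw [← hN2 j]
    refine Finset.sum_congr rfl fun i hi => ?_
    simp only [(Finset.mem_filter.1 hi).2]

end FiniteCombinatorics

/-! ### Regular refinements of weighted towers -/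

universe u

/-- A tower of sets `T 0 → T 1 → T 2 → …` with finite fibers, carrying weights that are additive
along the fibers. At level `n` the weights lie between `2 ^ (n + 2)` times the unit `2 ^ m n` and
`2 ^ (-(n + 7))` times the next unit `2 ^ m (n + 1)`, so that the relative errors made by rounding
to multiples of the units are summable. -/
structure WeightedTower where
  /-- The levels. -/
  T : ℕ → Type u
  /-- The map from a level to the next one. -/
  π : ∀ n, T n → T (n + 1)
  /-- The fibers of `π n`. -/
  fiber : ∀ n, T (n + 1) → Finset (T n)
  mem_fiber : ∀ n x t, t ∈ fiber n x ↔ π n t = x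
  /-- The weights. -/
  weight : ∀ n, T n → ℝ
  weight_succ : ∀ n x, weight (n + 1) x = ∑ t ∈ fiber n x, weight n t
  /-- The binary logarithms of the units. -/
  m : ℕ → ℕ
  /-- Upper bounds for the weights. -/
  B : ℕ → ℝ
  le_weight : ∀ n t, (2 : ℝ) ^ m n * 2 ^ (n + 2) ≤ weight n t
  weight_le : ∀ n t, weight n t ≤ B n
  B_mul_le : ∀ n, B n * 2 ^ (n + 7) ≤ 2 ^ m (n + 1)

namespace WeightedTower

variable (W : WeightedTower.{u})

theorem weight_pos (n : ℕ) (t : W.T n) : 0 < W.weight n t :=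
  lt_of_lt_of_le (by positivity) (W.le_weight n t)

/-- Multiplicities `N` at level `n` that are, in multiples of the unit, proportional to the
weights, with a factor in `[2 - 2 ^ (-n), 3 + 2 ^ (-n)]`. -/
def Admissible (n : ℕ) (N : W.T n → ℕ) : Prop :=
  ∀ t, (2 - 2⁻¹ ^ n) * W.weight n t ≤ N t * 2 ^ W.m n ∧
    (N t : ℝ) * 2 ^ W.m n ≤ (3 + 2⁻¹ ^ n) * W.weight n t

/-- Multiplicities `N` at level `n` and `N'` at level `n + 1` are coherent along a labelling `c`
of level `n` if the labels on the fiber over `x` are smaller than `N' x`, and for each such label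
the multiplicities of the points of the fiber with this label add up to
`2 ^ (m (n + 1) - m n)`. -/
def Coherent (n : ℕ) (N : W.T n → ℕ) (c : W.T n → ℕ) (N' : W.T (n + 1) → ℕ) : Prop :=
  (∀ t, c t < N' (W.π n t)) ∧
    ∀ x, ∀ j < N' x, ∑ t ∈ W.fiber n x with c t = j, N t = 2 ^ (W.m (n + 1) - W.m n)

variable {W}

theorem m_lt_m_succ (n : ℕ) (t : W.T n) : W.m n < W.m (n + 1) := by
  have h1 := W.le_weight n t
  have h2 := W.weight_le n t
  have h3 := W.B_mul_le n
  have h4 : (2 : ℝ) ^ W.m n < 2 ^ W.m (n + 1) := by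
    have h5 : (2 : ℝ) ^ W.m n * 2 ^ (n + 2) * 2 ^ (n + 7) ≤ 2 ^ W.m (n + 1) :=
      (mul_le_mul_of_nonneg_right (h1.trans h2) (by positivity)).trans h3
    refine lt_of_lt_of_le ?_ h5
    rw [← pow_add, ← pow_add]
    exact pow_lt_pow_right₀ one_lt_two (by omega)
  exact (pow_lt_pow_iff_right₀ one_lt_two).1 h4

theorem Admissible.pos {n : ℕ} {N : W.T n → ℕ} (h : W.Admissible n N) (t : W.T n) : 0 < N t := by
  by_contra h0
  have h1 := (h t).1
  have h2 : (2⁻¹ : ℝ) ^ n ≤ 1 := pow_le_one₀ (by norm_num) (by norm_num)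
  have h3 : (N t : ℝ) = 0 := by exact_mod_cast Nat.eq_zero_of_not_pos h0
  rw [h3, zero_mul] at h1
  nlinarith [W.weight_pos n t]

theorem exists_admissible (n : ℕ) : ∃ N, W.Admissible n N := by
  have h2 : (2⁻¹ : ℝ) ^ n ≤ 1 := pow_le_one₀ (by norm_num) (by norm_num)
  have h0 : (0 : ℝ) ≤ 2⁻¹ ^ n := by positivity
  refine ⟨fun t => ⌈2 * W.weight n t / 2 ^ W.m n⌉₊, fun t => ?_⟩
  have hw := W.weight_pos n t
  have hD : (0 : ℝ) < 2 ^ W.m n := by positivity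
  have h3 : 2 * W.weight n t ≤ (⌈2 * W.weight n t / 2 ^ W.m n⌉₊ : ℝ) * 2 ^ W.m n :=
    (div_le_iff₀ hD).1 (Nat.le_ceil _)
  have h4 : (⌈2 * W.weight n t / 2 ^ W.m n⌉₊ : ℝ) * 2 ^ W.m n
      ≤ 2 * W.weight n t + 2 ^ W.m n := by
    have := mul_le_mul_of_nonneg_right
      (Nat.ceil_lt_add_one (a := 2 * W.weight n t / 2 ^ W.m n) (by positivity)).le hD.le
    rwa [add_mul, div_mul_cancel₀ _ hD.ne', one_mul] at this
  have h5 : (2 : ℝ) ^ W.m n ≤ W.weight n t :=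
    le_trans (le_mul_of_one_le_right hD.le (one_le_pow₀ one_le_two)) (W.le_weight n t)
  constructor
  · nlinarith
  · nlinarith

/-- Admissible multiplicities propagate coherently from each level to the level below. -/
theorem Admissible.exists_coherent {n : ℕ} {N' : W.T (n + 1) → ℕ} (hN' : W.Admissible (n + 1) N') :
    ∃ N c, W.Admissible n N ∧ W.Coherent n N c N' := by
  have hx : ∀ x, ∃ (N : W.T n → ℕ) (c : W.T n → Fin (N' x)),
      (∀ t ∈ W.fiber n x, (2 - 2⁻¹ ^ n) * W.weight n t ≤ N t * 2 ^ W.m n ∧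
        (N t : ℝ) * 2 ^ W.m n ≤ (3 + 2⁻¹ ^ n) * W.weight n t) ∧
      ∀ j, ∑ t ∈ W.fiber n x with c t = j, N t = 2 ^ (W.m (n + 1) - W.m n) := by
    intro x
    have hne : (W.fiber n x).Nonempty := by
      rw [Finset.nonempty_iff_ne_empty]
      intro h
      have h1 := W.weight_pos (n + 1) x
      rw [W.weight_succ, h, Finset.sum_empty] at h1
      exact h1.false
    obtain ⟨t₀, -⟩ := hne
    have hm := m_lt_m_succ n t₀
    have hPD : ((2 ^ (W.m (n + 1) - W.m n) : ℕ) : ℝ) * 2 ^ W.m n = 2 ^ W.m (n + 1) := by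
      push_cast
      rw [← pow_add]
      congr 1
      omega
    have h1 : (2⁻¹ : ℝ) ^ n ≤ 1 := pow_le_one₀ (by norm_num) (by norm_num)
    have h0 : (0 : ℝ) < 2⁻¹ ^ n := by positivity
    have hinv : (2⁻¹ : ℝ) ^ n * 2 ^ n = 1 := by
      rw [← mul_pow]
      norm_num
    have hB0 : 0 ≤ W.B n := (W.weight_pos n t₀).le.trans (W.weight_le n t₀)
    have hN1 := hN' x
    rw [W.weight_succ, pow_succ] at hN1
    -- with `τ = 2 ^ (-n)`, the bounds on the weights say exactly that the unit is at most `τ / 4`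
    -- times a weight, and that a weight is at most `τ / 128` times the next unit
    generalize hτ : (2⁻¹ : ℝ) ^ n = τ at *
    refine exists_partition_with_multiplicities (W.fiber n x) (W.weight n)
      (B := W.B n) (α' := 2 - τ * 2⁻¹) (β' := 3 + τ * 2⁻¹) (η := τ / 4) (κ := τ / 128)
      (by positivity) hB0 (fun t _ => ⟨(W.weight_pos n t).le, W.weight_le n t⟩)
      (fun t _ => ?_) ?_ (by linarith) (by linarith) (by linarith) (by linarith) (by linarith)
      ?_ ?_ (hN'.pos x) ?_ ?_
    · have h2 := mul_le_mul_of_nonneg_left (W.le_weight n t) h0.le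
      have h3 : τ * (2 ^ W.m n * 2 ^ (n + 2)) = 2 ^ W.m n * 4 := by
        rw [pow_add]
        linear_combination (2 ^ W.m n * 4) * hinv
      linarith
    · rw [hPD]
      have h2 := mul_le_mul_of_nonneg_left (W.B_mul_le n) h0.le
      have h3 : τ * (W.B n * 2 ^ (n + 7)) = W.B n * 128 := by
        rw [pow_add]
        linear_combination (W.B n * 128) * hinv
      linarith
    · nlinarith [mul_nonneg h0.le h0.le, mul_nonneg (mul_nonneg h0.le h0.le) (sub_nonneg.2 h1)]
    · nlinarith [mul_nonneg h0.le h0.le, mul_nonneg h0.le (sub_nonneg.2 h1)]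
    · rw [hPD]
      exact hN1.1
    · rw [hPD]
      exact hN1.2
  choose N c hN hc using hx
  refine ⟨fun t => N (W.π n t) t, fun t => c (W.π n t) t, fun t => ?_, fun t => ?_, ?_⟩
  · exact hN _ t ((W.mem_fiber n _ t).2 rfl)
  · exact (c (W.π n t) t).2
  · intro x j hj
    rw [← hc x ⟨j, hj⟩]
    refine Finset.sum_congr ?_ fun t ht => ?_
    · ext t
      simp only [Finset.mem_filter, W.mem_fiber]
      refine and_congr_right fun ht => ?_
      subst ht
      exact ⟨fun h => Fin.ext h, fun h => congrArg Fin.val h⟩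
    · have := (W.mem_fiber n _ t).1 (Finset.mem_filter.1 ht).1
      simp only [this]

theorem exists_coherent_below (M : ℕ) {N' : W.T M → ℕ} (hN' : W.Admissible M N') :
    ∃ N c : ∀ n, W.T n → ℕ, N M = N' ∧ (∀ n ≤ M, W.Admissible n (N n)) ∧
      ∀ n < M, W.Coherent n (N n) (c n) (N (n + 1)) := by
  induction M with
  | zero =>
    refine ⟨Function.update (fun _ _ => 0) 0 N', fun _ _ => 0, Function.update_self _ _ _, ?_,
      by simp⟩
    intro n hn
    obtain rfl : n = 0 := by omega
    rwa [Function.update_self]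
  | succ M ih =>
    obtain ⟨N₁, c₁, hN₁, hc₁⟩ := hN'.exists_coherent
    obtain ⟨N, c, hNM, hN, hc⟩ := ih hN₁
    refine ⟨Function.update N (M + 1) N', Function.update c M c₁, Function.update_self _ _ _,
      fun n hn => ?_, fun n hn => ?_⟩
    · by_cases h : n = M + 1
      · subst h
        rwa [Function.update_self]
      · rw [Function.update_of_ne h]
        exact hN n (by omega)
    · rw [Function.update_of_ne (by omega : n ≠ M + 1)]
      by_cases h : n = M
      · subst h
        rwa [Function.update_self, Function.update_self, hNM]
      · rw [Function.update_of_ne h, Function.update_of_ne (by omega : n + 1 ≠ M + 1)]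
        exact hc n (by omega)

variable (W)

/-- Coherent multiplicities exist on the whole tower. Each finite part of the tower carries them,
and as their values at a given point are bounded, they converge along an ultrafilter. -/
theorem exists_coherent :
    ∃ N c : ∀ n, W.T n → ℕ, (∀ n t, 0 < N n t) ∧
      ∀ n, W.Coherent n (N n) (c n) (N (n + 1)) := by
  have h : ∀ M, ∃ N c : ∀ n, W.T n → ℕ, (∀ n ≤ M, W.Admissible n (N n)) ∧
      ∀ n < M, W.Coherent n (N n) (c n) (N (n + 1)) := fun M => by
    obtain ⟨N', hN'⟩ := W.exists_admissible M
    obtain ⟨N, c, -, h⟩ := exists_coherent_below M hN'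
    exact ⟨N, c, h⟩
  choose N c hN hc using h
  let U : Ultrafilter ℕ := Ultrafilter.of Filter.atTop
  have hU : ∀ n : ℕ, ∀ᶠ M in (U : Filter ℕ), n < M := fun n =>
    Ultrafilter.of_le Filter.atTop (Filter.eventually_gt_atTop n)
  have hlim : ∀ (f : ℕ → ℕ) (b : ℕ), (∀ᶠ M in (U : Filter ℕ), f M ≤ b) →
      ∃ a, ∀ᶠ M in (U : Filter ℕ), f M = a := fun f b hf => by
    have h1 : ∀ᶠ M in (U : Filter ℕ), ∃ a ∈ Set.Iic b, f M = a :=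
      hf.mono fun M hM => ⟨f M, hM, rfl⟩
    obtain ⟨a, -, ha⟩ := (Ultrafilter.eventually_exists_mem_iff (Set.finite_Iic b)).1 h1
    exact ⟨a, ha⟩
  have hNb : ∀ n t, ∃ b : ℕ, ∀ M, n ≤ M → N M n t ≤ b := fun n t => by
    refine ⟨⌊(3 + 2⁻¹ ^ n) * W.weight n t⌋₊, fun M hM => Nat.le_floor ?_⟩
    refine le_trans ?_ (hN M n hM t).2
    exact le_mul_of_one_le_right (Nat.cast_nonneg _) (one_le_pow₀ one_le_two)
  have hNlim : ∀ n t, ∃ a, ∀ᶠ M in (U : Filter ℕ), N M n t = a := fun n t => by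
    obtain ⟨b, hb⟩ := hNb n t
    exact hlim _ b ((hU n).mono fun M hM => hb M hM.le)
  have hclim : ∀ n t, ∃ a, ∀ᶠ M in (U : Filter ℕ), c M n t = a := fun n t => by
    obtain ⟨b, hb⟩ := hNb (n + 1) (W.π n t)
    exact hlim _ b ((hU n).mono fun M hM => ((hc M n hM).1 t).le.trans (hb M hM))
  choose N' hN' using hNlim
  choose c' hc' using hclim
  refine ⟨N', c', fun n t => ?_, fun n => ⟨fun t => ?_, fun x j hj => ?_⟩⟩
  · obtain ⟨M, h1, h2⟩ := ((hN' n t).and (hU n)).exists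
    rw [← h1]
    exact (hN M n h2.le).pos t
  · obtain ⟨M, h1, h2, h3⟩ :=
      ((hN' (n + 1) (W.π n t)).and ((hc' n t).and (hU n))).exists
    rw [← h1, ← h2]
    exact (hc M n h3).1 t
  · have hall : ∀ᶠ M in (U : Filter ℕ), ∀ t ∈ W.fiber n x, N M n t = N' n t ∧ c M n t = c' n t :=
      (Filter.eventually_all_finset _).2 fun t _ => (hN' n t).and (hc' n t)
    obtain ⟨M, h1, h2, h3⟩ := ((hN' (n + 1) x).and (hall.and (hU n))).exists
    rw [← h1] at hj
    rw [← (hc M n h3).2 x j hj]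
    refine Finset.sum_congr (Finset.filter_congr fun t ht => ?_) fun t ht => ?_
    · rw [(h2 t ht).2]
    · rw [(h2 t (Finset.mem_filter.1 ht).1).1]

end WeightedTower

/-! ### Coordinates on regular towers -/

section Coordinates

/-- The composite `Y 0 → Y n` of the first `n` maps of a tower. -/
def climb {Y : ℕ → Type u} (p : ∀ n, Y n → Y (n + 1)) : ∀ n, Y 0 → Y n
  | 0 => id
  | n + 1 => fun y => p n (climb p n y)

/-- If all fibers of `p` have `2 ^ (b - a)` points, then each fiber can be labelled bijectively by
the binary digits at the positions `k` with `a ≤ k < b`. -/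
theorem exists_digits {A B : Type u} (p : A → B) (a b : ℕ)
    (hcard : ∀ z, Nat.card {y // p y = z} = 2 ^ (b - a)) :
    ∃ d : A → ℕ → Fin 2,
      (∀ y y', p y = p y' → (∀ k, a ≤ k → k < b → d y k = d y' k) → y = y') ∧
        ∀ z (v : ℕ → Fin 2), ∃ y, p y = z ∧ ∀ k, a ≤ k → k < b → d y k = v k := by
  have hE : ∀ z, Nonempty ({y // p y = z} ≃ (Fin (b - a) → Fin 2)) := fun z => by
    have : Finite {y // p y = z} := Nat.finite_of_card_ne_zero (by rw [hcard]; positivity)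
    refine Finite.card_eq.1 ?_
    rw [hcard, Nat.card_eq_fintype_card, Fintype.card_fun, Fintype.card_fin, Fintype.card_fin]
  let E := fun z => (hE z).some
  refine ⟨fun y k => if h : k - a < b - a then E (p y) ⟨y, rfl⟩ ⟨k - a, h⟩ else 0, ?_, ?_⟩
  · intro y y' hyy' h
    have h1 : ∀ z (hy : p y = z) (hy' : p y' = z),
        (∀ k, E z ⟨y, hy⟩ k = E z ⟨y', hy'⟩ k) → y = y' := fun z hy hy' hk =>
      congrArg Subtype.val ((E z).injective (funext hk))
    refine h1 (p y') hyy' rfl fun k => ?_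
    have h2 := h (a + k) (by omega) (by omega)
    have h3 : a + (k : ℕ) - a < b - a := by omega
    have h4 : (⟨a + k - a, h3⟩ : Fin (b - a)) = k := Fin.ext (by simp)
    beta_reduce at h2
    rw [dif_pos h3, dif_pos h3, h4] at h2
    have h5 : ∀ z (hz : p y = z), E (p y) ⟨y, rfl⟩ k = E z ⟨y, hz⟩ k := by
      rintro _ rfl
      rfl
    rw [← h5, h2]
  · intro z v
    obtain ⟨⟨y, hy⟩, hyv⟩ := (E z).surjective fun k => v (a + k)
    refine ⟨y, hy, fun k hak hkb => ?_⟩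
    subst hy
    beta_reduce
    rw [dif_pos (by omega : k - a < b - a), hyv]
    exact congrArg v (Nat.add_sub_cancel' hak)

/-- A tower whose fibers at level `n` all have `2 ^ (m (n + 1) - m n)` points, and any two of
whose points have the same image at some level, is the integer part of the bi-cube: its `n`-th
level consists of the classes of sequences that agree from position `m n` on. Digits are
normalized by subtracting those of a base point, which makes all but finitely many of them
vanish. -/
theorem exists_biCube_coordinates {Y : ℕ → Type u} (p : ∀ n, Y n → Y (n + 1)) (m : ℕ → ℕ)
    (hm : StrictMono m) (hm0 : m 0 = 0)
    (hcard : ∀ n z, Nat.card {y // p n y = z} = 2 ^ (m (n + 1) - m n))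
    (hlim : ∀ y y', ∃ n, climb p n y = climb p n y') (y₀ : Y 0) :
    ∃ c : Y 0 → CantorBiCube,
      (∀ n y y', climb p n y = climb p n y' ↔ ∀ i : ℤ, m n ≤ i → (c y).1 i = (c y').1 i) ∧
        ∀ v : CantorBiCube, ∃ y, ∀ i : ℤ, 0 ≤ i → (c y).1 i = v.1 i := by
  choose d hinj hsurj using fun n => exists_digits (p n) (m n) (m (n + 1)) (hcard n)
  have hlev : ∀ k, ∃ n, m n ≤ k ∧ k < m (n + 1) := fun k => by
    refine ⟨Nat.findGreatest (fun n => m n ≤ k) k, ?_, ?_⟩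
    · exact Nat.findGreatest_spec (P := fun n => m n ≤ k) (Nat.zero_le k) (by omega)
    · by_contra h
      have h1 := hm.le_apply (x := Nat.findGreatest (fun n => m n ≤ k) k + 1)
      have h2 := Nat.le_findGreatest (P := fun n => m n ≤ k)
        (h1.trans (not_lt.1 h)) (not_lt.1 h)
      omega
  choose lev hlev1 hlev2 using hlev
  have hlev_ge : ∀ n k, m n ≤ k → n ≤ lev k := fun n k h => by
    have := hm.lt_iff_lt.1 (h.trans_lt (hlev2 k))
    omega
  have hlev_eq : ∀ n k, m n ≤ k → k < m (n + 1) → lev k = n := fun n k h h' => by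
    have := hm.lt_iff_lt.1 ((hlev1 k).trans_lt h')
    have := hlev_ge n k h
    omega
  have hclimb : ∀ {y y'} n N, n ≤ N → climb p n y = climb p n y' →
      climb p N y = climb p N y' := fun n N hnN h => by
    induction N, hnN using Nat.le_induction with
    | base => exact h
    | succ N _ ih => exact congrArg (p N) ih
  -- the normalized digit at position `k`
  let e : Y 0 → ℕ → Fin 2 := fun y k =>
    d (lev k) (climb p (lev k) y) k - d (lev k) (climb p (lev k) y₀) k
  have he : ∀ {n y y'}, climb p n y = climb p n y' → ∀ k, m n ≤ k → e y k = e y' k := by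
    intro n y y' h k hk
    simp only [e]
    rw [hclimb n (lev k) (hlev_ge n k hk) h]
  have he_inj : ∀ {y y'} j n, climb p (n + j) y = climb p (n + j) y' →
      (∀ k, m n ≤ k → e y k = e y' k) → climb p n y = climb p n y' := by
    intro y y' j
    induction j with
    | zero => exact fun n h _ => h
    | succ j ih =>
      intro n h hk
      have h1 : climb p (n + 1) y = climb p (n + 1) y' := by
        refine ih (n + 1) ?_ fun k hk' => hk k ((hm.monotone (Nat.le_succ n)).trans hk')
        rw [add_right_comm]
        exact h
      refine hinj n _ _ h1 fun k hk1 hk2 => ?_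
      have h2 := hk k hk1
      simp only [e] at h2
      rw [hlev_eq n k hk1 hk2] at h2
      exact sub_left_injective h2
  have he_base : ∀ k, e y₀ k = 0 := fun k => sub_self _
  let c : Y 0 → CantorBiCube := fun y =>
    ⟨fun i => if i < 0 then 0 else e y i.toNat, by
      obtain ⟨n, hn⟩ := hlim y y₀
      refine ⟨m n, fun i hi => ?_⟩
      beta_reduce
      rw [if_neg (by omega), he hn _ (by omega), he_base]⟩
  have hc : ∀ y (i : ℤ), 0 ≤ i → (c y).1 i = e y i.toNat := fun y i hi => if_neg (not_lt.2 hi)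
  refine ⟨c, fun n y y' => ⟨fun h i hi => ?_, fun h => ?_⟩, fun v => ?_⟩
  · rw [hc _ _ (by omega), hc _ _ (by omega)]
    exact he h _ (by omega)
  · obtain ⟨N, hN⟩ := hlim y y'
    refine he_inj N n (hclimb N (n + N) (by omega) hN) fun k hk => ?_
    have := h k (by omega)
    rwa [hc _ _ (by omega), hc _ _ (by omega)] at this
  · have hbuild : ∀ n (z : Y n), ∃ y, climb p n y = z ∧ ∀ k < m n, e y k = v.1 k := by
      intro n
      induction n with
      | zero => exact fun z => ⟨z, rfl, fun k hk => by omega⟩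
      | succ n ih =>
        intro z
        obtain ⟨w, hwz, hw⟩ := hsurj n z fun k => v.1 k + d n (climb p n y₀) k
        obtain ⟨y, hyw, hy⟩ := ih w
        refine ⟨y, by rw [← hwz, ← hyw]; rfl, fun k hk => ?_⟩
        by_cases hk' : k < m n
        · exact hy k hk'
        · simp only [e]
          rw [hlev_eq n k (not_lt.1 hk') hk, hyw, hw k (not_lt.1 hk') hk]
          exact add_sub_cancel_right _ _
    obtain ⟨M, hM⟩ := v.2
    obtain ⟨y, hy, hyv⟩ := hbuild (M + 1) (climb p (M + 1) y₀)
    refine ⟨y, fun i hi => ?_⟩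
    rw [hc _ _ hi]
    by_cases hi' : i.toNat < m (M + 1)
    · rw [hyv _ hi', Int.toNat_of_nonneg hi]
    · have h1 := hm.le_apply (x := M + 1)
      rw [he hy _ (not_lt.1 hi'), he_base, hM i (by omega)]

/-- Interleaving a weighted tower with a regular one yields coordinates in the bi-cube that
determine, and are determined by, the levels of the tower up to a shift by one level. -/
theorem WeightedTower.exists_biCube_coordinates (W : WeightedTower.{u}) (hm0 : W.m 0 = 0)
    (hlim : ∀ t t', ∃ n, climb W.π n t = climb W.π n t') (t₀ : W.T 0) :
    ∃ c : W.T 0 → CantorBiCube,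
      (∀ n t t', climb W.π n t = climb W.π n t' →
        ∀ i : ℤ, W.m (n + 1) ≤ i → (c t).1 i = (c t').1 i) ∧
      (∀ n t t', (∀ i : ℤ, W.m n ≤ i → (c t).1 i = (c t').1 i) →
        climb W.π n t = climb W.π n t') ∧
      ∀ v : CantorBiCube, ∃ t, ∀ i : ℤ, W.m 1 ≤ i → (c t).1 i = v.1 i := by
  obtain ⟨N, l, hN, hl⟩ := W.exists_coherent
  have hm : StrictMono W.m := strictMono_nat_of_lt_succ fun n => m_lt_m_succ n (climb W.π n t₀)
  -- level `n` of the regular tower has `N n t` points over `t`, and its map to the next level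
  -- factors through `W.T n`
  let Y : ℕ → Type u := fun n => Σ t : W.T n, Fin (N n t)
  let q : ∀ n, W.T n → Y (n + 1) := fun n t => ⟨W.π n t, ⟨l n t, (hl n).1 t⟩⟩
  let p : ∀ n, Y n → Y (n + 1) := fun n y => q n y.1
  have hfst : ∀ n y, (climb p n y).1 = climb W.π n y.1 := fun n y => by
    induction n with
    | zero => rfl
    | succ n ih => exact congrArg (W.π n) ih
  have hsucc : ∀ n y y', climb W.π n y.1 = climb W.π n y'.1 →
      climb p (n + 1) y = climb p (n + 1) y' := fun n y y' h => by
    have h1 : (climb p n y).1 = (climb p n y').1 := by rw [hfst, hfst, h]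
    exact congrArg (q n) h1
  have hcard : ∀ n z, Nat.card {y // p n y = z} = 2 ^ (W.m (n + 1) - W.m n) := by
    rintro n ⟨x, j⟩
    rw [← (hl n).2 x j j.2, Nat.subtype_card
      (((W.fiber n x).filter fun t => l n t = j).sigma
        fun t => (Finset.univ : Finset (Fin (N n t))))]
    · rw [Finset.card_sigma]
      simp only [Finset.card_univ, Fintype.card_fin]
    · rintro ⟨t, k⟩
      simp only [Finset.mem_sigma, Finset.mem_filter, Finset.mem_univ, and_true, W.mem_fiber]
      constructor
      · rintro ⟨rfl, h⟩
        exact congrArg (Sigma.mk _) (Fin.ext h)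
      · intro h
        simp only [p, q] at h
        cases h
        exact ⟨rfl, rfl⟩
  obtain ⟨c, hc, hdense⟩ := _root_.exists_biCube_coordinates p W.m hm hm0 hcard
    (fun y y' => by
      obtain ⟨n, hn⟩ := hlim y.1 y'.1
      exact ⟨n + 1, hsucc n y y' hn⟩) ⟨t₀, ⟨0, hN 0 t₀⟩⟩
  refine ⟨fun t => c ⟨t, ⟨0, hN 0 t⟩⟩, fun n t t' h => ?_, fun n t t' h => ?_, fun v => ?_⟩
  · exact (hc (n + 1) _ _).1 (hsucc n _ _ h)
  · have := congrArg Sigma.fst ((hc n _ _).2 h)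
    rwa [hfst, hfst] at this
  · obtain ⟨y, hy⟩ := hdense v
    refine ⟨y.1, fun i hi => ?_⟩
    rw [← hy i (by omega)]
    exact (hc 1 ⟨y.1, ⟨0, hN 0 y.1⟩⟩ y).1 (hsucc 0 _ _ rfl) i hi

end Coordinates

/-! ### The tower of chain components -/

section ComponentTower

variable {X : Type u} [MetricSpace X]

/-- Two points are equivalent if they lie in the same `s`-component. -/
def chainSetoid (X : Type u) [MetricSpace X] (s : ℝ) : Setoid X where
  r x y := y ∈ chainComponent s x
  iseqv := ⟨fun _ => mem_chainComponent_self, mem_chainComponent_symm,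
    fun h h' => mem_chainComponent_trans h' h⟩

/-- The map sending an `s`-component to the `t`-component containing it, for `s ≤ t`. -/
def chainQuotientMap {s t : ℝ} (hst : s ≤ t) :
    Quotient (chainSetoid X s) → Quotient (chainSetoid X t) :=
  Quotient.map id fun _ _ h => mem_chainComponent_mono hst h

theorem encard_chainQuotientMap_fiber {δ ε : ℝ} (h : δ ≤ ε) (x : X) :
    {q | chainQuotientMap h q = Quotient.mk (chainSetoid X ε) x}.encard
      = componentCount δ ε x := by
  let F : Quotient (chainSetoid X δ) → Set X :=
    Quotient.lift (chainComponent δ) fun a b hab => (chainComponent_eq_iff.2 hab).symm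
  have hF : Function.Injective F := by
    rintro ⟨a⟩ ⟨b⟩ hab
    exact Quotient.sound (chainComponent_eq_iff.1 (show chainComponent δ a = chainComponent δ b
      from hab).symm)
  rw [← hF.encard_image, componentCount]
  congr 1
  ext C
  constructor
  · rintro ⟨⟨y⟩, hy, rfl⟩
    exact ⟨y, mem_chainComponent_symm (Quotient.exact hy), rfl⟩
  · rintro ⟨y, hy, rfl⟩
    exact ⟨Quotient.mk _ y, Quotient.sound (mem_chainComponent_symm hy), rfl⟩

/-- Scales `ε n` and exponents `m n` for which the components at the scales `ε n` form a weighted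
tower: the numbers of `δ`-components in `ε n`-components are, up to a factor `4`, large in
comparison with `2 ^ m n` and small in comparison with `2 ^ m (n + 1)`. -/
theorem exists_scales {δ : ℝ} (h : Filter.Tendsto (fun ε : ℝ => thetaMin X δ ε) Filter.atTop (𝓝 ⊤))
    (b : ℝ → ℕ) :
    ∃ (ε : ℕ → ℝ) (m : ℕ → ℕ), ε 0 = δ ∧ m 0 = 0 ∧ Monotone ε ∧ (∀ r : ℝ, ∃ n, r ≤ ε n) ∧
      (∀ n, 4 * b (ε n) * 2 ^ (n + 7) ≤ 2 ^ m (n + 1)) ∧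
      ∀ n, ((2 ^ m (n + 1) * 2 ^ (n + 1) : ℕ) : ℕ∞) ≤ thetaMin X δ (ε (n + 1)) := by
  have h1 : ∀ (K : ℕ) (e : ℝ), ∃ e', e ≤ e' ∧ (K : ℝ) ≤ e' ∧ (K : ℕ∞) ≤ thetaMin X δ e' := by
    intro K e
    obtain ⟨e', h2, h3, h4⟩ := ((ENat.tendsto_nhds_top_iff_natCast_lt.1 h K).and
      ((Filter.eventually_ge_atTop e).and (Filter.eventually_ge_atTop (K : ℝ)))).exists
    exact ⟨e', h3, h4, h2.le⟩
  choose next hnext1 hnext2 hnext3 using h1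
  let M : ℕ → ℝ → ℕ := fun n e => 4 * b e * 2 ^ (n + 7)
  let K : ℕ → ℝ → ℕ := fun n e => 2 ^ M n e * 2 ^ (n + 1)
  let ε : ℕ → ℝ := fun n => Nat.rec δ (fun n e => next (K n e) e) n
  have hε : ∀ n, ε (n + 1) = next (K n (ε n)) (ε n) := fun n => rfl
  let m : ℕ → ℕ := fun n => Nat.casesOn n 0 fun n => M n (ε n)
  refine ⟨ε, m, rfl, rfl, monotone_nat_of_le_succ fun n => hnext1 _ _, fun r => ?_, fun n => ?_,
    fun n => hnext3 _ _⟩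
  · obtain ⟨n, hn⟩ := exists_nat_ge r
    refine ⟨n + 1, hn.trans (le_trans ?_ (hnext2 (K n (ε n)) (ε n)))⟩
    have h2 : n ≤ K n (ε n) :=
      calc n ≤ 2 ^ (n + 1) := (Nat.le_succ n).trans (Nat.lt_two_pow_self).le
        _ ≤ K n (ε n) := Nat.le_mul_of_pos_left _ (by positivity)
    exact_mod_cast h2
  · exact (Nat.lt_two_pow_self).le

/-- The components at suitably chosen scales `ε n` form a weighted tower, a component weighing
four times the number of `δ`-components it contains. The bi-cube coordinates of this tower, read
on the points of `X`, are the required map. -/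
theorem exists_isDenseCoarseEmbedding_of_theta [Nonempty X] (hdim : MacroUniformDimensionZero X)
    {δ : ℝ} (hsup : ∀ ε : ℝ, δ ≤ ε → thetaSup X δ ε < ⊤)
    (hmin : Filter.Tendsto (fun ε : ℝ => thetaMin X δ ε) Filter.atTop (𝓝 ⊤)) :
    ∃ f : X → CantorBiCube, IsDenseCoarseEmbedding f := by
  classical
  obtain ⟨ε, m, hε0, hm0, hmono, hunb, hb, hθ⟩ :=
    exists_scales hmin fun e => (thetaSup X δ e).toNat
  subst hε0
  let T : ℕ → Type u := fun n => Quotient (chainSetoid X (ε n))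
  let π : ∀ n, T n → T (n + 1) := fun n => chainQuotientMap (hmono n.le_succ)
  let up : ∀ n, T 0 → T n := fun n => chainQuotientMap (hmono n.zero_le)
  have hπup : ∀ n q, π n (up n q) = up (n + 1) q := by
    rintro n ⟨x⟩
    rfl
  have hup_surj : ∀ n, Function.Surjective (up n) := by
    rintro n ⟨x⟩
    exact ⟨Quotient.mk _ x, rfl⟩
  have hcount : ∀ n (t : T n), thetaMin X (ε 0) (ε n) ≤ {q | up n q = t}.encard ∧
      {q | up n q = t}.encard ≤ thetaSup X (ε 0) (ε n) := by
    rintro n ⟨x⟩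
    rw [show {q | up n q = Quot.mk _ x}.encard = componentCount (ε 0) (ε n) x from
      encard_chainQuotientMap_fiber (hmono n.zero_le) x]
    exact ⟨iInf_le _ x, le_iSup (componentCount (ε 0) (ε n)) x⟩
  have hsup' : ∀ n, thetaSup X (ε 0) (ε n) ≠ ⊤ := fun n => (hsup _ (hmono n.zero_le)).ne
  have hfin : ∀ n (t : T n), {q | up n q = t}.Finite := fun n t =>
    Set.encard_lt_top_iff.1 ((hcount n t).2.trans_lt (hsup _ (hmono n.zero_le)))
  have hfib : ∀ n (x : T (n + 1)), {t | π n t = x}.Finite := fun n x => by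
    refine ((hfin (n + 1) x).image (up n)).subset fun t ht => ?_
    obtain ⟨q, rfl⟩ := hup_surj n t
    exact ⟨q, (hπup n q).symm.trans ht, rfl⟩
  have hcard : ∀ n (t : T n), (((hfin n t).toFinset.card : ℕ) : ℕ∞) = {q | up n q = t}.encard :=
    fun n t => ((hfin n t).encard_eq_coe_toFinset_card).symm
  let W : WeightedTower.{u} :=
    { T := T
      π := π
      fiber := fun n x => (hfib n x).toFinset
      mem_fiber := fun n x t => by simp
      weight := fun n t => 4 * ((hfin n t).toFinset.card : ℝ)
      weight_succ := fun n x => by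
        rw [← Finset.mul_sum]
        congr 1
        rw [Finset.card_eq_sum_card_fiberwise (f := up n) (t := (hfib n x).toFinset)]
        · push_cast
          refine Finset.sum_congr rfl fun t ht => ?_
          have ht' : π n t = x := by simpa using ht
          congr 2
          ext q
          simp only [Finset.mem_filter, Set.Finite.mem_toFinset, Set.mem_ofPred_eq]
          refine ⟨fun h => h.2, fun h => ⟨?_, h⟩⟩
          rw [← hπup, h, ht']
        · intro q hq
          have hq' : up (n + 1) q = x := by simpa using hq
          simp [hπup, hq']
      m := m
      B := fun n => 4 * ((thetaSup X (ε 0) (ε n)).toNat : ℝ)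
      le_weight := fun n t => by
        cases n with
        | zero =>
          -- a `δ`-component contains itself, and the factor `4` gives the required lower bound
          obtain ⟨q, hq⟩ := hup_surj 0 t
          have h1 : 1 ≤ (hfin 0 t).toFinset.card :=
            Finset.card_pos.2 ⟨q, by simpa using hq⟩
          have h2 : (1 : ℝ) ≤ ((hfin 0 t).toFinset.card : ℝ) := by exact_mod_cast h1
          rw [hm0, pow_zero, zero_add]
          linarith
        | succ n =>
          have h1 := (hθ n).trans (hcount (n + 1) t).1
          rw [← hcard] at h1
          have h2 : 2 ^ m (n + 1) * 2 ^ (n + 1) ≤ (hfin (n + 1) t).toFinset.card := by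
            exact_mod_cast h1
          have h3 : (2 : ℝ) ^ m (n + 1) * 2 ^ (n + 1) ≤ ((hfin (n + 1) t).toFinset.card : ℝ) := by
            exact_mod_cast h2
          rw [pow_add (2 : ℝ) (n + 1) 2]
          linarith
      weight_le := fun n t => by
        have h1 := (hcount n t).2
        rw [← hcard, ← ENat.natCast_toNat (hsup' n)] at h1
        have h2 : (hfin n t).toFinset.card ≤ (thetaSup X (ε 0) (ε n)).toNat := by
          exact_mod_cast h1
        have h3 : ((hfin n t).toFinset.card : ℝ) ≤ ((thetaSup X (ε 0) (ε n)).toNat : ℝ) := by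
          exact_mod_cast h2
        linarith
      B_mul_le := fun n => by exact_mod_cast hb n }
  have hclimb : ∀ n q, climb W.π n q = up n q := fun n q => by
    induction n with
    | zero =>
      obtain ⟨x, rfl⟩ := Quotient.exists_rep q
      rfl
    | succ n ih => exact (congrArg (π n) ih).trans (hπup n q)
  have hup : ∀ n (x y : X), up n (Quotient.mk _ x) = up n (Quotient.mk _ y) ↔
      y ∈ chainComponent (ε n) x := fun n x y =>
    ⟨fun h => Quotient.exact h, fun h => Quotient.sound h⟩
  obtain ⟨x₀⟩ := ‹Nonempty X›
  obtain ⟨c, hc1, hc2, hc3⟩ := W.exists_biCube_coordinates hm0 (fun t t' => by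
    obtain ⟨x, rfl⟩ := Quotient.exists_rep t
    obtain ⟨y, rfl⟩ := Quotient.exists_rep t'
    obtain ⟨n, hn⟩ := hunb (dist y x)
    refine ⟨n, ?_⟩
    rw [hclimb, hclimb]
    exact (hup n x y).2 (mem_chainComponent_of_dist_le hn)) (Quotient.mk _ x₀)
  have hm : StrictMono m := strictMono_nat_of_lt_succ fun n =>
    WeightedTower.m_lt_m_succ (W := W) n (Quotient.mk _ x₀)
  refine ⟨fun x => c (Quotient.mk _ x), ⟨fun r => ?_, fun r => ?_, ?_⟩⟩
  · obtain ⟨n, hn⟩ := hunb r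
    refine ⟨2 ^ (m (n + 1) : ℤ), fun x x' h => CantorBiCube.dist_le_two_zpow_iff.2 fun i hi => ?_⟩
    refine hc1 n _ _ ?_ i hi.le
    rw [hclimb, hclimb, hup]
    rw [dist_comm] at h
    exact mem_chainComponent_of_dist_le (h.trans hn)
  · obtain ⟨k, hk⟩ := CantorBiCube.exists_le_two_zpow r
    obtain ⟨s, hs⟩ := macroUniformDimensionZero_iff.1 hdim (ε (k + 1))
    refine ⟨s, fun x x' h => ?_⟩
    have h1 := CantorBiCube.dist_le_two_zpow_iff.1 (h.trans hk)
    have h2 := hc2 (k + 1) _ _ fun i hi => h1 i (by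
      have h3 := hm.le_apply (x := k + 1)
      have h4 : (m (k + 1) : ℤ) ≤ i := hi
      omega)
    rw [hclimb, hclimb, hup] at h2
    exact hs _ _ (mem_chainComponent_symm h2)
  · refine ⟨2 ^ (m 1 : ℤ), fun v => ?_⟩
    obtain ⟨t, ht⟩ := hc3 v
    obtain ⟨x, rfl⟩ := Quotient.exists_rep t
    exact ⟨x, CantorBiCube.dist_le_two_zpow_iff.2 fun i hi => ht i hi.le⟩

end ComponentTower

/-! ### The characterization -/

theorem mainTheorem1 (X : Type*) [MetricSpace X] [Nonempty X] :
    (MacroUniformlyEquivalent X CantorBiCube ↔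
      MacroUniformDimensionZero X ∧
        ∃ δ : ℝ, 0 < δ ∧ (∀ ε : ℝ, δ ≤ ε → thetaSup X δ ε < ⊤) ∧
          Filter.Tendsto (fun ε : ℝ => thetaMin X δ ε) Filter.atTop (𝓝 ⊤)) ∧
    (CoarselyEquivalent X CantorBiCube ↔ MacroUniformlyEquivalent X CantorBiCube) ∧
    (MacroUniformlyEquivalent X extendedCantorSet ↔
      MacroUniformlyEquivalent X CantorBiCube) := by
  simp only [macroUniformlyEquivalent_iff, coarselyEquivalent_iff, true_and]
  refine ⟨⟨?_, ?_⟩, ?_⟩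
  · rintro ⟨f, hf⟩
    obtain ⟨δ, hδ⟩ := hf.control_inv 1
    exact ⟨hf.macroUniformDimensionZero, max δ 1, by positivity,
      fun ε _ => hf.thetaSup_lt_top (fun x x' h => (hδ x x' h).trans (le_max_left _ _)) ε,
      hf.tendsto_thetaMin _⟩
  · rintro ⟨hdim, δ, -, hsup, hmin⟩
    exact exists_isDenseCoarseEmbedding_of_theta hdim hsup hmin
  · obtain ⟨g, hg⟩ := exists_isDenseCoarseEmbedding_extendedCantorSet
    obtain ⟨g', hg'⟩ := hg.exists_symm
    exact ⟨fun ⟨f, hf⟩ => ⟨g ∘ f, hg.comp hf⟩, fun ⟨f, hf⟩ => ⟨g' ∘ f, hg'.comp hf⟩⟩
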